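/- **Constraints.** A constraint is a function $f:\{0,1\}^k\to\mathbb{R}^{\ge 0}$ ($k$ is its arity); a binary constraint is written $(f(00),f(01),f(10),f(11))$, and $\mathit{Implies}=(1,1,0,1)$. Let $\mathcal{U}$ be the set of all unary constraints. A constraint $f$ is *degenerate* if $f(x_1,\dots,x_k)=\prod_{i=1}^k u_i(x_i)$ for some unary $u_1,\dots,u_k$. $\mathcal{IM}_{\mathrm{opt}}$ is the set of all constraints that are finite products of unary constraints $u(x_i)$ and constraints $g(x_i,x_j)$, $i\ne j$, with $g=(1,1,\lambda,1)$, $0\le\lambda<1$. A constraint $f$ has *imp support* if $\{x : f(x)\neq 0\}$ is the set of solutions of a conjunction of a positive number of relations of the forms $x_i=0$, $x_i=1$, and $\mathit{Implies}(x_i,x_j)$ with $i\neq j$. **Problems.** For a set $\mathcal{F}$ of constraints, an instance of $\mathrm{MAX\text{-}PROD\text{-}CSP}(\mathcal{F})$ is a finite set $H$ of pairs $\langle h,(x_{i_1},\dots,x_{i_k})\rangle$ on Boolean variables $x_1,\dots,x_n$, with $h\in\mathcal{F}$ of arity $k$; a solution is an assignment $\sigma$ of truth values to $x_1,\dots,x_n$,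 and its measure, to be maximized, is $\prod_{\langle h,(x_{i_1},\dots,x_{i_k})\rangle\in H}h(\sigma(x_{i_1}),\dots,\sigma(x_{i_k}))$. $\mathrm{MAX\text{-}PROD\text{-}CSP}^*(g,\mathcal{F})$ denotes $\mathrm{MAX\text{-}PROD\text{-}CSP}(\{g\}\cup\mathcal{F}\cup\mathcal{U})$. An instance is presented as a finite sequence of real numbers ($n$ in unary, and for every element of $H$ the indices and the table of values of $h$); its size $|x|$ is the sum of the lengths of these numbers, where the length of a real $r$ is $1+\lceil|\log_2|r||\rceil$, and $1$ if $r=0$. **Reductions.** For a maximization problem with measure $m$ and optimum value $m^*(x)$, a solution $y$ for $x$ is $\alpha$-approximate if $1/\alpha\le m(x,y)/m^*(x)\le\alpha$ when $m^*(x)\neq0$, and $m(x,y)=0$ when $m^*(x)=0$. A randomized approximation scheme takes $(x,\varepsilon)$, where $x$ is an instance and $0<\varepsilon<1$, and outputs with probability at least $3/4$ a $2^{\varepsilon}$-approximate solution for $x$. A problem $P$ is *APT-reducible* to a problem $Q$ if there are a randomized oracle program $N$ (a program over finitely many stacks of real numbers with finitely many real constants, the field operations, comparisons, coin tosses and oracle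 calls, where every step takes unit time except that writing a number takes its length) and a polynomial $p$ such that, for every randomized approximation scheme $M$ for $Q$ (of any running time) used as an oracle, every instance $x$ of $P$ and every $\varepsilon\in(0,1)$: (i) the output of $N$ on $(x,\varepsilon)$ is, with probability at least $3/4$, a $2^\varepsilon$-approximate solution for $x$; (ii) every oracle call is a pair $(w,\delta)$ with $w$ an instance of $Q$, $0<\delta<1$ and $1/\delta\le p(|x|,1/\varepsilon)$, and it is answered by a fresh outcome of $M$ on $(w,\delta)$; (iii) $N$ always halts within time $p(|x|,1/\varepsilon)$. **Lemma.** Let $\mathcal{F}$ be any set of constraints. If $f\in\mathcal{IM}_{\mathrm{opt}}$ is non-degenerate and does not have imp support, then $\mathrm{MAX\text{-}PROD\text{-}CSP}^*(\mathit{Implies},\mathcal{F})$ is APT-reducible to $\mathrm{MAX\text{-}PROD\text{-}CSP}^*(f,\mathcal{F})$. -/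

import Mathlib

open scoped NNReal ENNReal

noncomputable section

namespace MaxProd

/-! ### Constraints -/

/-- A nonnegative-real-weighted constraint: a function `{0,1}^k → ℝ≥0`, where `k` is its arity. -/
structure Constraint where
  arity : ℕ
  val : (Fin arity → Bool) → ℝ≥0

/-- The two-place function `(a, b, c, d)`, listed as the values at `00, 01, 10, 11`. -/
def table2 (a b c d : ℝ≥0) : Bool → Bool → ℝ≥0
  | false, false => a
  | false, true => b
  | true, false => c
  | true, true => d

/-- `Implies = (1, 1, 0, 1)`. -/
def Implies : Constraint where
  arity := 2
  val x := table2 1 1 0 1 (x 0) (x 1)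

/-- The set of all unary constraints. -/
def Unary : Set Constraint := {f | f.arity = 1}

/-- Degenerate constraints: products of unary constraints applied to different variables. -/
def Degenerate (f : Constraint) : Prop :=
  ∃ u : Fin f.arity → Bool → ℝ≥0, ∀ x, f.val x = ∏ i, u i (x i)

/-- The admissible factors of a constraint in `IM_opt`: a unary constraint applied to a variable,
or `(1, 1, l, 1)` with `0 ≤ l < 1` applied to two distinct variables. -/
inductive IMFactor (k : ℕ) : Type
  | unary (i : Fin k) (u : Bool → ℝ≥0)
  | imp (i j : Fin k) (hij : i ≠ j) (l : ℝ≥0) (hl : l < 1)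

def IMFactor.eval {k : ℕ} (x : Fin k → Bool) : IMFactor k → ℝ≥0
  | .unary i u => u (x i)
  | .imp i j _ l _ => table2 1 1 l 1 (x i) (x j)

/-- The set `IM_opt`: all finite products of admissible factors. -/
def IMopt : Set Constraint :=
  {f | ∃ L : List (IMFactor f.arity), ∀ x, f.val x = (L.map (IMFactor.eval x)).prod}

/-- The relations `Δ₀(x_i)`, `Δ₁(x_i)` and `Implies(x_i, x_j)`, where `x_i`, `x_j` are distinct
variables. -/
inductive ImpAtom (k : ℕ) : Type
  | zero (i : Fin k)
  | one (i : Fin k)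
  | implies (i j : Fin k) (hij : i ≠ j)

def ImpAtom.Holds {k : ℕ} (x : Fin k → Bool) : ImpAtom k → Prop
  | .zero i => x i = false
  | .one i => x i = true
  | .implies i j _ => x i = true → x j = true

/-- `f` has imp support: `{x | f x ≠ 0}` is a conjunction of a positive number of relations
`Δ₀(x_i)`, `Δ₁(x_i)`, `Implies(x_i, x_j)`. -/
def HasImpSupport (f : Constraint) : Prop :=
  ∃ L : List (ImpAtom f.arity), L ≠ [] ∧ ∀ x, f.val x ≠ 0 ↔ ∀ a ∈ L, a.Holds x

/-! ### Maximization problems -/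

/-- The length of a real number, `1 + ⌈|log₂ |r||⌉` (and `1` for `r = 0`): the number of binary
places that its order of magnitude takes. -/
def len (r : ℝ) : ℕ := 1 + ⌈|Real.logb 2 r|⌉₊

/-- A maximization problem with instance set `Inst`. Solutions are bit strings, and an instance is
handed to a machine as a finite sequence of real numbers. -/
structure MaxProblem where
  Inst : Type
  sol : Inst → Set (List Bool)
  meas : Inst → List Bool → ℝ≥0
  meas_eq_zero : ∀ x, ∀ y ∉ sol x, meas x y = 0
  code : Inst → List ℝ
  code_injective : Function.Injective code

/-- The size `|x|` of an instance: the total length of the numbers in its code. -/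
def MaxProblem.size (P : MaxProblem) (x : P.Inst) : ℕ := ((P.code x).map len).sum

/-- `y` is an `α`-approximate solution for `x`; `v` is the optimum value `m*(x)`. -/
def MaxProblem.IsApprox (P : MaxProblem) (α : ℝ) (x : P.Inst) (y : List Bool) : Prop :=
  y ∈ P.sol x ∧ ∃ v, IsGreatest (P.meas x '' P.sol x) v ∧
    (v = 0 → P.meas x y = 0) ∧
    (v ≠ 0 → 1 / α ≤ (P.meas x y : ℝ) / v ∧ (P.meas x y : ℝ) / v ≤ α)

/-! ### The problem MAX-PROD-CSP -/

/-- An element `⟨h, (x_{i_1}, …, x_{i_k})⟩` on the variables `x_0, …, x_{n-1}`. -/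
structure Applied (n : ℕ) where
  con : Constraint
  scope : Fin con.arity → Fin n

/-- An instance of MAX-PROD-CSP(F): a number `n` of variables and a finite set of constraint
applications, given as a list without repetitions. -/
structure CSPInst (F : Set Constraint) where
  n : ℕ
  cons : List (Applied n)
  nodup : cons.Nodup
  mem : ∀ c ∈ cons, c.con ∈ F

/-- `{0,1}^k` in lexicographic order. -/
def points : (k : ℕ) → List (Fin k → Bool)
  | 0 => [Fin.elim0]
  | k + 1 => (points k).map (Fin.cons false) ++ (points k).map (Fin.cons true)

/-- The values of a constraint in lexicographic order. -/
def Constraint.table (f : Constraint) : List ℝ := (points f.arity).map fun x => (f.val x : ℝ)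

/-- The code of `⟨h, (x_{i_1}, …, x_{i_k})⟩`: the indices and the table of `h`, each closed by the
separator `-1`, which occurs nowhere else. -/
def Applied.code {n : ℕ} (c : Applied n) : List ℝ :=
  List.ofFn (fun j => ((c.scope j : ℕ) : ℝ)) ++ -1 :: (c.con.table ++ [-1])

/-- The code of an instance: `n` in unary, the separator `-1`, and the codes of the elements. -/
def CSPInst.code {F : Set Constraint} (x : CSPInst F) : List ℝ :=
  List.replicate x.n 1 ++ -1 :: x.cons.flatMap Applied.code

/-- The product of the values of all constraints under the assignment `σ`. -/
def CSPInst.value {F : Set Constraint} (x : CSPInst F) (σ : Fin x.n → Bool) : ℝ≥0 :=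
  (x.cons.map fun c => c.con.val fun j => σ (c.scope j)).prod

lemma sep_inj {a b c d : List ℝ} (ha : (-1 : ℝ) ∉ a) (hb : (-1 : ℝ) ∉ b)
    (h : a ++ -1 :: c = b ++ -1 :: d) : a = b ∧ c = d := by
  induction a generalizing b with
  | nil =>
    cases b with
    | nil => simpa using h
    | cons y b =>
      simp only [List.nil_append, List.cons_append, List.cons.injEq] at h
      exact absurd (h.1 ▸ List.mem_cons_self) hb
  | cons x a ih =>
    cases b with
    | nil =>
      simp only [List.nil_append, List.cons_append, List.cons.injEq] at h
      exact absurd (h.1 ▸ List.mem_cons_self) ha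
    | cons y b =>
      simp only [List.cons_append, List.cons.injEq, List.mem_cons, not_or] at *
      obtain ⟨h1, h2⟩ := ih ha.2 hb.2 h.2
      exact ⟨⟨h.1, h1⟩, h2⟩

lemma mem_points : ∀ (k : ℕ) (x : Fin k → Bool), x ∈ points k
  | 0, x => by simp [points, eq_iff_true_of_subsingleton]
  | k + 1, x => by
    have h := mem_points k (Fin.tail x)
    have e := Fin.cons_self_tail x
    simp only [points, List.mem_append, List.mem_map]
    cases hx : x 0
    · exact Or.inl ⟨_, h, by rw [← hx]; exact e⟩
    · exact Or.inr ⟨_, h, by rw [← hx]; exact e⟩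

lemma neg_one_not_mem_scope {n k : ℕ} (s : Fin k → Fin n) :
    (-1 : ℝ) ∉ List.ofFn (fun j => ((s j : ℕ) : ℝ)) := by
  rw [List.mem_ofFn]
  rintro ⟨j, hj⟩
  have : (0 : ℝ) ≤ ((s j : ℕ) : ℝ) := Nat.cast_nonneg _
  linarith

lemma neg_one_not_mem_table (f : Constraint) : (-1 : ℝ) ∉ f.table := by
  simp only [Constraint.table, List.mem_map, not_exists, not_and]
  intro x _ hx
  have := (f.val x).2
  change (0 : ℝ) ≤ (f.val x : ℝ) at this
  linarith

lemma applied_inj {n : ℕ} {c d : Applied n} {r s : List ℝ}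
    (h : c.code ++ r = d.code ++ s) : c = d ∧ r = s := by
  simp only [Applied.code, List.append_assoc, List.cons_append, List.nil_append] at h
  obtain ⟨h1, h2⟩ := sep_inj (neg_one_not_mem_scope _) (neg_one_not_mem_scope _) h
  obtain ⟨h3, h4⟩ := sep_inj (neg_one_not_mem_table _) (neg_one_not_mem_table _) h2
  refine ⟨?_, h4⟩
  obtain ⟨⟨k, f⟩, u⟩ := c
  obtain ⟨⟨l, g⟩, v⟩ := d
  have hkl : k = l := by simpa using congrArg List.length h1
  subst hkl
  have huv : u = v := by
    have := List.ofFn_injective h1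
    funext j
    have hj := congrFun this j
    exact Fin.ext (by exact_mod_cast hj)
  have hfg : f = g := by
    funext x
    have := List.map_inj_left.1 h3 x (mem_points k x)
    exact_mod_cast this
  subst huv hfg
  rfl

lemma applied_code_ne_nil {n : ℕ} (c : Applied n) : c.code ≠ [] := by
  simp [Applied.code]

lemma flatMap_code_inj {n : ℕ} : ∀ {L K : List (Applied n)},
    L.flatMap Applied.code = K.flatMap Applied.code → L = K
  | [], [], _ => rfl
  | [], d :: K, h => by simp [applied_code_ne_nil] at h
  | c :: L, [], h => by simp [applied_code_ne_nil] at h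
  | c :: L, d :: K, h => by
    simp only [List.flatMap_cons] at h
    obtain ⟨h1, h2⟩ := applied_inj h
    rw [h1, flatMap_code_inj h2]

lemma csp_code_injective (F : Set Constraint) :
    Function.Injective (CSPInst.code : CSPInst F → List ℝ) := by
  rintro ⟨n, L, hL, hL'⟩ ⟨m, K, hK, hK'⟩ h
  have aux : ∀ k : ℕ, (-1 : ℝ) ∉ List.replicate k (1 : ℝ) := by
    intro k hk
    have := List.eq_of_mem_replicate hk
    norm_num at this
  obtain ⟨h1, h2⟩ := sep_inj (aux _) (aux _) h
  have hnm : n = m := by simpa using congrArg List.length h1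
  subst hnm
  have := flatMap_code_inj h2
  subst this
  rfl

/-- MAX-PROD-CSP(F). A solution is a truth assignment, written as the bit string
`σ(x_0) … σ(x_{n-1})`. -/
def maxProdCSP (F : Set Constraint) : MaxProblem where
  Inst := CSPInst F
  sol x := {y | y.length = x.n}
  meas x y := if h : y.length = x.n then x.value fun i => y.get (i.cast h.symm) else 0
  meas_eq_zero _ _ h := dif_neg h
  code := CSPInst.code
  code_injective := csp_code_injective F

/-- MAX-PROD-CSP*(F) is MAX-PROD-CSP(F ∪ U), where `U` is the set of all unary constraints. -/
def maxProdCSPStar (F : Set Constraint) : MaxProblem := maxProdCSP (F ∪ Unary)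

/-! ### Randomized oracle machines over the real numbers

The memory consists of stacks (one-ended tapes) of real numbers. A program uses finitely many of
them and finitely many real constants. -/

/-- The field operations. Division by zero gives zero. -/
inductive Op
  | add | sub | mul | div

def Op.eval : Op → ℝ → ℝ → ℝ
  | .add => (· + ·)
  | .sub => (· - ·)
  | .mul => (· * ·)
  | .div => (· / ·)

abbrev Store := ℕ → List ℝ

/-- The top of stack `a`; it reads as zero if the stack is empty. -/
def Store.top (s : Store) (a : ℕ) : ℝ := (s a).headD 0

def Store.push (s : Store) (a : ℕ) (r : ℝ) : Store := Function.update s a (r :: s a)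

/-- Tests: "the top of `a` is at most the top of `b`", and "stack `a` is empty". -/
inductive Test
  | le (a b : ℕ)
  | empty (a : ℕ)

def Test.Holds (s : Store) : Test → Prop
  | .le a b => s.top a ≤ s.top b
  | .empty a => s a = []

/-- Programs. -/
inductive Prog
  /-- Do nothing. -/
  | nop
  /-- Push the constant `r` on stack `a`. -/
  | push (r : ℝ) (a : ℕ)
  /-- Remove the top of stack `a`. -/
  | pop (a : ℕ)
  /-- Push the top of `a` on `b`. -/
  | copy (a b : ℕ)
  /-- Push the result of an operation on the tops of `a` and `b` on stack `c`. -/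
  | arith (o : Op) (a b c : ℕ)
  /-- Push a uniformly random bit on stack `a`. -/
  | flip (a : ℕ)
  /-- Ask the oracle the question on stack `q`, which is erased; the answer replaces the content
  of stack `a`. -/
  | query (q a : ℕ)
  | seq (P Q : Prog)
  | branch (t : Test) (P Q : Prog)
  /-- Repeat `P` as long as the test holds. -/
  | loop (t : Test) (P : Prog)

/-- A configuration: the programs still to be executed in turn, the memory, and the time used. -/
structure Config where
  todo : List Prog
  store : Store
  clock : ℕ

/-- An oracle: it takes the code of an instance and an error tolerance, and draws a bit string. -/
abbrev Oracle := List ℝ → ℝ → PMF (List Bool)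

/-- A bit string as a stack content. -/
def bits (y : List Bool) : List ℝ := y.map fun b => if b then 1 else 0

open Classical in
/-- One step. It takes one unit of time, except that writing the number `r` takes `len r` units.
A question consists of the error tolerance, on top, and the code of an instance. Different oracle
calls and coin tosses are independent. -/
def step (M : Oracle) (c : Config) : PMF Config :=
  match c.todo with
  | [] => PMF.pure c
  | .nop :: k => PMF.pure ⟨k, c.store, c.clock + 1⟩
  | .push r a :: k => PMF.pure ⟨k, c.store.push a r, c.clock + len r⟩
  | .pop a :: k => PMF.pure ⟨k, Function.update c.store a (c.store a).tail, c.clock + 1⟩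
  | .copy a b :: k =>
      PMF.pure ⟨k, c.store.push b (c.store.top a), c.clock + len (c.store.top a)⟩
  | .arith o a b d :: k =>
      PMF.pure ⟨k, c.store.push d (o.eval (c.store.top a) (c.store.top b)),
        c.clock + len (o.eval (c.store.top a) (c.store.top b))⟩
  | .flip a :: k =>
      (PMF.uniformOfFintype Bool).map fun b =>
        ⟨k, c.store.push a (if b then 1 else 0), c.clock + 1⟩
  | .query q a :: k =>
      (M (c.store q).tail (c.store.top q)).map fun y =>
        ⟨k, Function.update (Function.update c.store q []) a (bits y), c.clock + 1⟩
  | .seq P Q :: k => PMF.pure ⟨P :: Q :: k, c.store, c.clock + 1⟩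
  | .branch t P Q :: k =>
      PMF.pure ⟨(if t.Holds c.store then P else Q) :: k, c.store, c.clock + 1⟩
  | .loop t P :: k =>
      PMF.pure ⟨if t.Holds c.store then P :: .loop t P :: k else k, c.store, c.clock + 1⟩

/-- The distribution of the configuration after `t` steps. A configuration with nothing left to
execute is final and does not change any more. -/
def run (M : Oracle) (c : Config) : ℕ → PMF Config
  | 0 => PMF.pure c
  | t + 1 => (run M c t).bind (step M)

/-- The initial configuration: `ε` and the code of the instance on stack `0`, all other stacks
empty. -/
def start (N : Prog) (ε : ℝ) (w : List ℝ) : Config :=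
  ⟨[N], Function.update (fun _ => []) 0 (ε :: w), 0⟩

/-- `M` is a randomized approximation scheme for `Q` (with no bound on its running time). -/
def IsScheme (Q : MaxProblem) (M : Oracle) : Prop :=
  ∀ (w : Q.Inst) (δ : ℝ), 0 < δ → δ < 1 →
    3 / 4 ≤ (M (Q.code w) δ).toOuterMeasure {y | Q.IsApprox (2 ^ δ) w y}

/-- `P` is APT-reducible to `Q`. One program `N` and one polynomial `p` serve all oracles.
The output is read off stack `1`. -/
def APTReduces (P Q : MaxProblem) : Prop :=
  ∃ (N : Prog) (p : MvPolynomial (Fin 2) ℝ), ∀ M : Oracle, IsScheme Q M →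
    ∀ (x : P.Inst) (ε : ℝ), 0 < ε → ε < 1 →
      -- every oracle call is `(w, δ)` with `0 < δ < 1` and `1/δ ≤ p(|x|, 1/ε)`
      (∀ t, ∀ c ∈ (run M (start N ε (P.code x)) t).support,
        ∀ q a k, c.todo = .query q a :: k →
          ∃ (w : Q.Inst) (δ : ℝ), c.store q = δ :: Q.code w ∧ 0 < δ ∧ δ < 1 ∧
            1 / δ ≤ MvPolynomial.eval ![(P.size x : ℝ), 1 / ε] p) ∧
      -- on every computation path, `N` halts in time at most `p(|x|, 1/ε)`, and its output is a
      -- `2^ε`-approximate solution for `x` with probability at least `3/4`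
      ∃ t, (∀ c ∈ (run M (start N ε (P.code x)) t).support,
          c.todo = [] ∧ (c.clock : ℝ) ≤ MvPolynomial.eval ![(P.size x : ℝ), 1 / ε] p) ∧
        3 / 4 ≤ (run M (start N ε (P.code x)) t).toOuterMeasure
          {c | ∃ y, c.store 1 = bits y ∧ P.IsApprox (2 ^ ε) x y}

end MaxProd

end

/-!
Since `f` has no imp support, all its factors are positive, and since it is not degenerate, one of
them is some `(1, 1, l, 1)` with `l < 1`. Every factor is log-supermodular, so pinning all other
variables of `f` to `0` leaves a positive binary function that is strictly log-supermodular.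
Multiplication by unary functions turns it into a multiple of `(1, 1, r, 1)` with `0 < r < 1`. Two
of these in series through a fresh variable `v`, on `(x, v)` and `(v, y)`, have at the best value of
`v` again the weight `(1, 1, r, 1)` on `(x, y)`, so `k` copies, each with its own `v`, have the
weight `(1, 1, r ^ k, 1)`.

If `Z` bounds the nonzero values of the product of the other constraints and their inverses, and
`r ^ k * Z ^ 2 < 1 / 2`, then violating an implication costs more than the factor `2` that the
oracle may lose. As `Z` is at most exponential in the size of the instance, a linear number `k` of
copies suffices.

An instance is a set of applied constraints and not a multiset. The unary ones that normalise the
different copies are kept apart by multiplying each with its own scalar, and no approximation ratio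
changes under scalars.
-/

noncomputable section

namespace MaxProd

/-! ### Binary weights and pinning -/

/-- Log-supermodularity of a binary weight on the lattice `{0,1}²`. -/
def LogSupermodular (g : Bool → Bool → ℝ≥0) : Prop :=
  g false true * g true false ≤ g false false * g true true

/-- Strict log-supermodularity of a binary weight on the lattice `{0,1}²`. -/
def StrictlyLogSupermodular (g : Bool → Bool → ℝ≥0) : Prop :=
  g false true * g true false < g false false * g true true

namespace LogSupermodular

lemma one : LogSupermodular fun _ _ => 1 := by
  simp [LogSupermodular]

lemma mul {g h : Bool → Bool → ℝ≥0} (hg : LogSupermodular g) (hh : LogSupermodular h) :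
    LogSupermodular fun x y => g x y * h x y := by
  simp only [LogSupermodular, mul_mul_mul_comm (g _ _)]
  exact mul_le_mul' hg hh

lemma list_prod {α : Type*} {g : α → Bool → Bool → ℝ≥0} {L : List α}
    (hg : ∀ a ∈ L, LogSupermodular (g a)) :
    LogSupermodular fun x y => (L.map fun a => g a x y).prod := by
  induction L with
  | nil => simpa using one
  | cons a L ih =>
    simp only [List.map_cons, List.prod_cons]
    exact (hg a List.mem_cons_self).mul (ih fun b hb => hg b (List.mem_cons_of_mem a hb))

end LogSupermodular

lemma StrictlyLogSupermodular.mul {g h : Bool → Bool → ℝ≥0} (hg : StrictlyLogSupermodular g)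
    (hh : LogSupermodular h) (h01 : h false true ≠ 0) (h10 : h true false ≠ 0) :
    StrictlyLogSupermodular fun x y => g x y * h x y := by
  simp only [StrictlyLogSupermodular, mul_mul_mul_comm (g _ _)]
  exact mul_lt_mul hg hh (pos_iff_ne_zero.2 (mul_ne_zero h01 h10)) zero_le

/-- The binary weight `(1, 1, l, 1)`. -/
def softImp (l : ℝ≥0) : Bool → Bool → ℝ≥0 := table2 1 1 l 1

lemma softImp_strictlyLogSupermodular {l : ℝ≥0} (hl : l < 1) :
    StrictlyLogSupermodular (softImp l) := by
  simpa [StrictlyLogSupermodular, softImp, table2] using hl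

lemma softImp_le_one {l : ℝ≥0} (hl : l ≤ 1) (x y : Bool) : softImp l x y ≤ 1 := by
  cases x <;> cases y <;> simp [softImp, table2, hl]

lemma softImp_of_eq_zero {x y : Bool} (h : softImp 0 x y = 0) (l : ℝ≥0) : softImp l x y = l := by
  revert h
  cases x <;> cases y <;> simp [softImp, table2]

lemma softImp_of_ne_zero {x y : Bool} (h : softImp 0 x y ≠ 0) (l : ℝ≥0) : softImp l x y = 1 := by
  revert h
  cases x <;> cases y <;> simp [softImp, table2]

lemma softImp_mul_le {l : ℝ≥0} (hl : l ≤ 1) (x y z : Bool) :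
    softImp l x z * softImp l z y ≤ softImp l x y := by
  cases x <;> cases y <;> cases z <;> simp [softImp, table2, hl]

lemma softImp_self (l : ℝ≥0) (x : Bool) : softImp l x x = 1 := by
  cases x <;> rfl

lemma softImp_pow (l : ℝ≥0) (m : ℕ) (x y : Bool) : softImp l x y ^ m = softImp (l ^ m) x y := by
  cases x <;> cases y <;> simp [softImp, table2]

/-- The point with entries `x`, `y` at the positions `i`, `j` and `o` elsewhere. -/
def pin {k : ℕ} {α : Type*} (i j : Fin k) (x y o : α) : Fin k → α :=
  fun p => if p = i then x else if p = j then y else o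

lemma apply_pin {k : ℕ} {α β : Type*} (σ : α → β) (i j : Fin k) (x y o : α) :
    (fun p => σ (pin i j x y o p)) = pin i j (σ x) (σ y) (σ o) := by
  funext p
  simp only [pin, apply_ite σ]

/-! ### Constraints of `IM_opt` -/

namespace IMFactor

/-- The relations on the variables that cut out the support of a factor. -/
def supportAtoms {k : ℕ} : IMFactor k → List (ImpAtom k)
  | .unary i u => (if u false = 0 then [.one i] else []) ++ (if u true = 0 then [.zero i] else [])
  | .imp i j hij l _ => if l = 0 then [.implies i j hij] else []

lemma eval_ne_zero_iff {k : ℕ} (x : Fin k → Bool) (a : IMFactor k) :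
    a.eval x ≠ 0 ↔ ∀ b ∈ a.supportAtoms, b.Holds x := by
  cases a with
  | unary i u =>
    by_cases h0 : u false = 0 <;> by_cases h1 : u true = 0 <;> cases hx : x i <;>
      simp [eval, supportAtoms, ImpAtom.Holds, h0, h1, hx]
  | imp i j hij l hl =>
    by_cases h0 : l = 0 <;> cases hx : x i <;> cases hy : x j <;>
      simp [eval, supportAtoms, ImpAtom.Holds, h0, hx, hy, table2]

lemma logSupermodular_eval_pin {k : ℕ} {i j : Fin k} (hij : i ≠ j) (a : IMFactor k) :
    LogSupermodular fun x y => a.eval (pin i j x y false) := by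
  cases a with
  | unary p u =>
    by_cases hi : p = i <;> by_cases hj : p = j <;> subst_vars <;>
      simp_all [LogSupermodular, eval, pin, mul_comm]
  | imp p r hpr l hl =>
    have := hl.le
    by_cases hi : p = i <;> by_cases hj : p = j <;> by_cases hi' : r = i <;>
      by_cases hj' : r = j <;> simp_all [LogSupermodular, eval, pin, table2]

lemma eval_imp_pin {k : ℕ} {i j : Fin k} (hij : i ≠ j) {l : ℝ≥0} (hl : l < 1) (x y o : Bool) :
    (imp i j hij l hl).eval (pin i j x y o) = softImp l x y := by
  simp [eval, pin, softImp, hij.symm]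

end IMFactor

lemma val_ne_zero_of_mem_IMopt {f : Constraint} (hf : f ∈ IMopt) (himp : ¬ HasImpSupport f)
    (x : Fin f.arity → Bool) : f.val x ≠ 0 := by
  obtain ⟨L, hL⟩ := hf
  have support : ∀ y, f.val y ≠ 0 ↔ ∀ b ∈ L.flatMap IMFactor.supportAtoms, b.Holds y := by
    intro y
    simp only [hL, ne_eq, List.prod_eq_zero_iff, List.mem_map, not_exists, not_and,
      List.mem_flatMap, forall_exists_index, and_imp]
    exact ⟨fun h b a ha => (a.eval_ne_zero_iff y).1 (h a ha) b,
      fun h a ha => (a.eval_ne_zero_iff y).2 fun b hb => h b a ha hb⟩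
  by_cases hnil : L.flatMap IMFactor.supportAtoms = []
  · exact (support x).2 (by simp [hnil])
  · exact absurd ⟨_, hnil, support⟩ himp

lemma degenerate_of_unary_factors {f : Constraint} {L : List (IMFactor f.arity)}
    (hL : ∀ x, f.val x = (L.map (IMFactor.eval x)).prod)
    (hunary : ∀ a ∈ L, ∃ i u, a = .unary i u) : Degenerate f := by
  let onPosition (i : Fin f.arity) (b : Bool) : IMFactor f.arity → ℝ≥0
    | .unary p u => if p = i then u b else 1
    | .imp _ _ _ _ _ => 1
  refine ⟨fun i b => (L.map (onPosition i b)).prod, fun x => ?_⟩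
  rw [hL]
  clear hL
  induction L with
  | nil => simp
  | cons a L ih =>
    obtain ⟨p, u, rfl⟩ := hunary _ List.mem_cons_self
    simp only [List.map_cons, List.prod_cons, Finset.prod_mul_distrib]
    rw [ih fun b hb => hunary b (List.mem_cons_of_mem _ hb)]
    simp [IMFactor.eval, onPosition]

lemma exists_strictlyLogSupermodular_pin {f : Constraint} (hf : f ∈ IMopt)
    (hdeg : ¬ Degenerate f) (hpos : ∀ x, f.val x ≠ 0) :
    ∃ i j : Fin f.arity, i ≠ j ∧
      StrictlyLogSupermodular fun x y => f.val (pin i j x y false) := by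
  obtain ⟨L, hL⟩ := hf
  obtain ⟨i, j, hij, l, hl, hmem⟩ : ∃ i j hij l hl, IMFactor.imp i j hij l hl ∈ L := by
    by_contra hno
    push Not at hno
    refine hdeg (degenerate_of_unary_factors hL fun a ha => ?_)
    cases a with
    | unary i u => exact ⟨i, u, rfl⟩
    | imp i j hij l hl => exact absurd ha (hno i j hij l hl)
  refine ⟨i, j, hij, ?_⟩
  obtain ⟨K₁, K₂, rfl⟩ := List.append_of_mem hmem
  have hsplit (x y : Bool) : f.val (pin i j x y false) = softImp l x y *
      ((K₁ ++ K₂).map fun a => a.eval (pin i j x y false)).prod := by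
    rw [hL, List.map_append, List.map_cons, List.prod_append, List.prod_cons,
      IMFactor.eval_imp_pin, mul_left_comm, ← List.prod_append, ← List.map_append]
  simp only [hsplit]
  have hrest (x y : Bool) : ((K₁ ++ K₂).map fun a => a.eval (pin i j x y false)).prod ≠ 0 :=
    right_ne_zero_of_mul (hsplit x y ▸ hpos (pin i j x y false))
  exact (softImp_strictlyLogSupermodular hl).mul
    (.list_prod fun a _ => a.logSupermodular_eval_pin hij) (hrest _ _) (hrest _ _)

/-! ### Replacing implications by a pinned constraint -/

/-- A constraint applied to variables that are arbitrary natural numbers, so that the set of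
variables can grow during a construction. -/
structure Application where
  con : Constraint
  scope : Fin con.arity → ℕ

/-- The code of an application, as in `Applied.code`. -/
def Application.code (c : Application) : List ℝ :=
  List.ofFn (fun j => (c.scope j : ℝ)) ++ -1 :: (c.con.table ++ [-1])

/-- The value of an application under the assignment `σ`. -/
def Application.eval (c : Application) (σ : ℕ → Bool) : ℝ≥0 := c.con.val fun j => σ (c.scope j)

/-- The measure of the assignment `σ`: the product of the values of all applications. -/
def weight (L : List Application) (σ : ℕ → Bool) : ℝ≥0 := (L.map fun c => c.eval σ).prod

lemma weight_cons (c : Application) (L : List Application) (σ : ℕ → Bool) :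
    weight (c :: L) σ = c.eval σ * weight L σ := by
  simp [weight]

lemma weight_append (K L : List Application) (σ : ℕ → Bool) :
    weight (K ++ L) σ = weight K σ * weight L σ := by
  simp [weight]

lemma weight_congr {L : List Application} {σ τ : ℕ → Bool}
    (h : ∀ c ∈ L, ∀ j, σ (c.scope j) = τ (c.scope j)) : weight L σ = weight L τ := by
  refine congrArg List.prod (List.map_congr_left fun c hc => ?_)
  simp only [Application.eval, h c hc]

/-- The unary constraint `(u, v)` applied to `x`. -/
def unaryApp (u v : ℝ≥0) (x : ℕ) : Application := ⟨⟨1, fun p => if p 0 then v else u⟩, fun _ => x⟩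

lemma unaryApp_eval (u v : ℝ≥0) (x : ℕ) (σ : ℕ → Bool) :
    (unaryApp u v x).eval σ = if σ x then v else u := rfl

lemma eq_and_eq_of_unaryApp_eq {u v u' v' : ℝ≥0} {x x' : ℕ}
    (h : unaryApp u v x = unaryApp u' v' x') : u = u' ∧ x = x' := by
  have hval := congrArg (fun c : Application => c.con.val fun _ => false) h
  have hscope := congrArg (fun c : Application => List.ofFn c.scope) h
  simpa [unaryApp] using And.intro hval hscope

/-- A positive constraint together with two positions at which its pinning is strictly
log-supermodular. -/
structure SupermodularPin where
  con : Constraint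
  fst : Fin con.arity
  snd : Fin con.arity
  fst_ne_snd : fst ≠ snd
  val_ne_zero : ∀ x, con.val x ≠ 0
  strict : StrictlyLogSupermodular fun x y => con.val (pin fst snd x y false)

namespace SupermodularPin

variable (G : SupermodularPin)

/-- The binary weight that arises by pinning all other positions to `false`. -/
def pinned (x y : Bool) : ℝ≥0 := G.con.val (pin G.fst G.snd x y false)

/-- The factor in front of the normalised weight `(1, 1, ratio, 1)`, see `pinned_normalize`. -/
def base : ℝ≥0 := G.pinned false false

/-- The value at `true` of the unary weight that normalises the first variable. -/
def sourceScale : ℝ≥0 := G.pinned false true / G.pinned true true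

/-- The value at `true` of the unary weight that normalises the second variable. -/
def targetScale : ℝ≥0 := G.pinned false false / G.pinned false true

/-- The cost of violating the implication, an invariant of `pinned` under unary weights. -/
def ratio : ℝ≥0 :=
  G.pinned false true * G.pinned true false / (G.pinned false false * G.pinned true true)

lemma pinned_pos (x y : Bool) : 0 < G.pinned x y := pos_iff_ne_zero.2 (G.val_ne_zero _)

lemma base_pos : 0 < G.base := G.pinned_pos _ _

lemma sourceScale_pos : 0 < G.sourceScale := div_pos (G.pinned_pos _ _) (G.pinned_pos _ _)

lemma targetScale_pos : 0 < G.targetScale := div_pos (G.pinned_pos _ _) (G.pinned_pos _ _)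

lemma ratio_pos : 0 < G.ratio :=
  div_pos (mul_pos (G.pinned_pos _ _) (G.pinned_pos _ _))
    (mul_pos (G.pinned_pos _ _) (G.pinned_pos _ _))

lemma ratio_lt_one : G.ratio < 1 :=
  (div_lt_one (mul_pos (G.pinned_pos _ _) (G.pinned_pos _ _))).2 G.strict

lemma con_val_false : G.con.val (fun _ => false) = G.base := by
  refine congrArg G.con.val (funext fun p => ?_)
  simp [pin]

lemma pinned_normalize (x y : Bool) :
    G.pinned x y * ((if x then G.sourceScale else 1) * (if y then G.targetScale else 1)) =
      G.base * softImp G.ratio x y := by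
  have h00 := (G.pinned_pos false false).ne'
  have h01 := (G.pinned_pos false true).ne'
  have h11 := (G.pinned_pos true true).ne'
  cases x <;> cases y <;>
    simp [base, sourceScale, targetScale, ratio, softImp, table2] <;> field_simp

/-- The constraint applied to `x` and `y` at the pinned positions and to `o` elsewhere; the
variable `o` is meant to have the value `false`. -/
def apply (x y o : ℕ) : Application := ⟨G.con, pin G.fst G.snd x y o⟩

lemma apply_eval (x y o : ℕ) {σ : ℕ → Bool} (ho : σ o = false) :
    (G.apply x y o).eval σ = G.pinned (σ x) (σ y) := by
  simp only [Application.eval, apply, pinned, apply_pin, ho]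

lemma apply_ne_unaryApp (x y o : ℕ) (u v : ℝ≥0) (z : ℕ) : G.apply x y o ≠ unaryApp u v z := by
  intro h
  have harity : G.con.arity = 1 := congrArg (fun c : Application => c.con.arity) h
  exact G.fst_ne_snd (Fin.ext (by omega))

lemma apply_ne_apply {x x' : ℕ} (hx : x ≠ x') (y y' o : ℕ) : G.apply x y o ≠ G.apply x' y' o := by
  simp only [apply, ne_eq, Application.mk.injEq, heq_eq_eq, true_and]
  intro h
  exact hx (by simpa [pin] using congrFun h G.fst)

/-- A copy of `(1, 1, ratio, 1)` on `(x, y)` as two such weights in series through the fresh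
variable `v`. An instance is a set of applications, so the copies must differ: those of the pinned
constraint do because `v` is fresh, the unary ones on `x` and `y` because they are multiplied by
`tag + 1` and `tag`, which exceed all values at `false` so far. -/
def link (x y o v : ℕ) (tag : ℝ≥0) : List Application :=
  [G.apply v y o, G.apply x v o, unaryApp 1 (G.sourceScale * G.targetScale) v,
    unaryApp (tag + 1) ((tag + 1) * G.targetScale) y, unaryApp tag (tag * G.sourceScale) x]

lemma weight_link (x y o v : ℕ) (tag : ℝ≥0) {σ : ℕ → Bool} (ho : σ o = false) :
    weight (G.link x y o v tag) σ = tag * (tag + 1) * G.base * G.base *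
      (softImp G.ratio (σ x) (σ v) * softImp G.ratio (σ v) (σ y)) := by
  simp only [link, weight_cons, G.apply_eval _ _ _ ho, unaryApp_eval]
  simp only [weight, List.map_nil, List.prod_nil]
  calc _ = tag * (tag + 1) * (G.pinned (σ x) (σ v) *
        ((if σ x then G.sourceScale else 1) * (if σ v then G.targetScale else 1))) *
        (G.pinned (σ v) (σ y) *
          ((if σ v then G.sourceScale else 1) * (if σ y then G.targetScale else 1))) := by
        split_ifs <;> ring
    _ = _ := by
        rw [pinned_normalize, pinned_normalize]
        ring

variable {G} {x y o v : ℕ} {tag : ℝ≥0} {c : Application}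

lemma nodup_link (hx : x ≠ v) (hy : y ≠ v) : (G.link x y o v tag).Nodup := by
  have happly := G.apply_ne_apply hx.symm y v o
  have hfresh (a b : ℝ≥0) {z : ℕ} (hz : z ≠ v) (w : ℝ≥0) : unaryApp 1 a v ≠ unaryApp b w z :=
    fun h => hz (eq_and_eq_of_unaryApp_eq h).2.symm
  have htag (a b : ℝ≥0) : unaryApp (tag + 1) a y ≠ unaryApp tag b x :=
    fun h => (lt_add_one tag).ne' (eq_and_eq_of_unaryApp_eq h).1
  simp [link, happly, apply_ne_unaryApp, hfresh _ _ hx, hfresh _ _ hy, htag]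

lemma con_of_mem_link (hc : c ∈ G.link x y o v tag) : c.con = G.con ∨ c.con ∈ Unary := by
  simp only [link, List.mem_cons, List.not_mem_nil, or_false] at hc
  rcases hc with rfl | rfl | rfl | rfl | rfl
  exacts [.inl rfl, .inl rfl, .inr rfl, .inr rfl, .inr rfl]

lemma scope_lt_of_mem_link (hx : x < v) (hy : y < v) (ho : o < v) (hc : c ∈ G.link x y o v tag)
    (j : Fin c.con.arity) : c.scope j < v + 1 := by
  have happly {a b : ℕ} (ha : a < v + 1) (hb : b < v + 1) (j) :
      (G.apply a b o).scope j < v + 1 := by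
    simp only [apply, pin]
    split_ifs <;> omega
  simp only [link, List.mem_cons, List.not_mem_nil, or_false] at hc
  rcases hc with rfl | rfl | rfl | rfl | rfl
  · exact happly (by omega) (by omega) j
  · exact happly (by omega) (by omega) j
  all_goals
    simp only [unaryApp]
    omega

lemma val_false_lt_of_mem_link (hbase : G.base < tag) (hone : 1 < tag)
    (hc : c ∈ G.link x y o v tag) : c.con.val (fun _ => false) < tag + 2 := by
  have htag : tag < tag + 2 := by simp
  simp only [link, List.mem_cons, List.not_mem_nil, or_false] at hc
  rcases hc with rfl | rfl | rfl | rfl | rfl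
  · exact (G.con_val_false.trans_lt hbase).trans htag
  · exact (G.con_val_false.trans_lt hbase).trans htag
  · simpa [unaryApp] using hone.trans htag
  · simp [unaryApp]
  · simp [unaryApp]

lemma fresh_or_tag_le_of_mem_link (hc : c ∈ G.link x y o v tag) :
    (∃ j, c.scope j = v) ∨ tag ≤ c.con.val (fun _ => false) := by
  simp only [link, List.mem_cons, List.not_mem_nil, or_false] at hc
  rcases hc with rfl | rfl | rfl | rfl | rfl
  · exact .inl ⟨G.fst, by simp [apply, pin]⟩
  · exact .inl ⟨G.snd, by simp [apply, pin, G.fst_ne_snd.symm]⟩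
  · exact .inl ⟨(0 : Fin 1), rfl⟩
  · exact .inr (by simp [unaryApp])
  · exact .inr (by simp [unaryApp])

end SupermodularPin

/-- An instance under construction: its applications, the number `fresh` of variables in use, and a
number `tag` above all values at `false … false`. -/
structure PartialInstance where
  applications : List Application
  fresh : ℕ
  tag : ℝ≥0

namespace SupermodularPin

variable (G : SupermodularPin)

/-- Adds a copy of `(1, 1, ratio, 1)` on `(x, y)`. -/
def addCopy (o x y : ℕ) (s : PartialInstance) : PartialInstance :=
  ⟨G.link x y o s.fresh s.tag ++ s.applications, s.fresh + 1, s.tag + 2⟩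

/-- Adds `m` copies of `(1, 1, ratio, 1)` on `(x, y)`, that is, a copy of `(1, 1, ratio ^ m, 1)`. -/
def addCopies (o m x y : ℕ) (s : PartialInstance) : PartialInstance := (G.addCopy o x y)^[m] s

/-- Adds `m` copies of `(1, 1, ratio, 1)` on each of the given pairs. -/
def addAll (o m : ℕ) (l : List (ℕ × ℕ)) (s : PartialInstance) : PartialInstance :=
  l.foldl (fun s p => G.addCopies o m p.1 p.2 s) s

lemma addCopies_succ (o m x y : ℕ) (s : PartialInstance) :
    G.addCopies o (m + 1) x y s = G.addCopies o m x y (G.addCopy o x y s) := rfl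

lemma addCopies_fresh (o m x y : ℕ) (s : PartialInstance) :
    (G.addCopies o m x y s).fresh = s.fresh + m := by
  induction m generalizing s with
  | zero => rfl
  | succ m ih =>
    rw [addCopies_succ, ih]
    simp only [addCopy]
    omega

lemma addCopies_tag (o m x y : ℕ) (s : PartialInstance) :
    (G.addCopies o m x y s).tag = s.tag + 2 * m := by
  induction m generalizing s with
  | zero => simp [addCopies]
  | succ m ih =>
    rw [addCopies_succ, ih]
    simp only [addCopy]
    push_cast
    ring

end SupermodularPin

namespace PartialInstance

/-- The syntactic invariant of the construction, for instances over the constraint set `S` in which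
the variable `o` is to have the value `false`. -/
structure Valid (G : SupermodularPin) (S : Set Constraint) (o : ℕ) (s : PartialInstance) :
    Prop where
  nodup : s.applications.Nodup
  scope_lt : ∀ c ∈ s.applications, ∀ j, c.scope j < s.fresh
  val_false_lt : ∀ c ∈ s.applications, c.con.val (fun _ => false) < s.tag
  con_mem : ∀ c ∈ s.applications, c.con ∈ S
  lt_fresh : o < s.fresh
  one_lt_tag : 1 < s.tag
  base_lt_tag : G.base < s.tag

variable {G : SupermodularPin} {S : Set Constraint} {o : ℕ} {s : PartialInstance}

namespace Valid

lemma addCopy (h : s.Valid G S o) (hG : G.con ∈ S) (hU : Unary ⊆ S) {x y : ℕ} (hx : x < s.fresh)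
    (hy : y < s.fresh) : (G.addCopy o x y s).Valid G S o where
  nodup := by
    refine (SupermodularPin.nodup_link hx.ne hy.ne).append h.nodup fun c hnew hold => ?_
    rcases SupermodularPin.fresh_or_tag_le_of_mem_link hnew with ⟨j, hj⟩ | htag
    · exact (h.scope_lt c hold j).ne hj
    · exact (h.val_false_lt c hold).not_ge htag
  scope_lt c hc := by
    rcases List.mem_append.1 hc with hc | hc
    · exact SupermodularPin.scope_lt_of_mem_link hx hy h.lt_fresh hc
    · exact fun j => (h.scope_lt c hc j).trans (Nat.lt_succ_self _)
  val_false_lt c hc := by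
    rcases List.mem_append.1 hc with hc | hc
    · exact SupermodularPin.val_false_lt_of_mem_link h.base_lt_tag h.one_lt_tag hc
    · exact (h.val_false_lt c hc).trans (lt_add_of_pos_right _ two_pos)
  con_mem c hc := by
    rcases List.mem_append.1 hc with hc | hc
    · exact (SupermodularPin.con_of_mem_link hc).elim (fun he => he ▸ hG) (fun hu => hU hu)
    · exact h.con_mem c hc
  lt_fresh := h.lt_fresh.trans (Nat.lt_succ_self _)
  one_lt_tag := h.one_lt_tag.trans (lt_add_of_pos_right _ two_pos)
  base_lt_tag := h.base_lt_tag.trans (lt_add_of_pos_right _ two_pos)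

lemma addCopies (h : s.Valid G S o) (hG : G.con ∈ S) (hU : Unary ⊆ S) (m : ℕ) {x y : ℕ}
    (hx : x < s.fresh) (hy : y < s.fresh) : (G.addCopies o m x y s).Valid G S o := by
  induction m generalizing s with
  | zero => exact h
  | succ _ ih =>
    exact ih (h.addCopy hG hU hx hy) (hx.trans (Nat.lt_succ_self _)) (hy.trans (Nat.lt_succ_self _))

lemma addAll (h : s.Valid G S o) (hG : G.con ∈ S) (hU : Unary ⊆ S) (m : ℕ) {l : List (ℕ × ℕ)}
    (hl : ∀ p ∈ l, p.1 < s.fresh ∧ p.2 < s.fresh) : (G.addAll o m l s).Valid G S o := by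
  induction l generalizing s with
  | nil => exact h
  | cons p l ih =>
    have hp := hl p List.mem_cons_self
    refine ih (h.addCopies hG hU m hp.1 hp.2) fun q hq => ?_
    have := hl q (List.mem_cons_of_mem p hq)
    rw [SupermodularPin.addCopies_fresh]
    omega

end Valid

/-- `s` represents the weight `H` up to the scale `C`: on assignments with `σ o = false`, `C * H σ`
is the largest measure over all choices of the variables from `o + 1` on. -/
structure Represents (o : ℕ) (s : PartialInstance) (H : (ℕ → Bool) → ℝ≥0) (C : ℝ≥0) : Prop where
  pos : 0 < C
  le : ∀ σ, σ o = false → weight s.applications σ ≤ C * H σ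
  attained : ∀ σ, σ o = false →
    ∃ τ, (∀ i ≤ o, τ i = σ i) ∧ weight s.applications τ = C * H σ

end PartialInstance

/-- The weight of the conjunction of the implications between the given pairs, softened to `l`. -/
def softWeight (l : ℝ≥0) (p : List (ℕ × ℕ)) (σ : ℕ → Bool) : ℝ≥0 :=
  (p.map fun q => softImp l (σ q.1) (σ q.2)).prod

namespace PartialInstance.Represents

variable {G : SupermodularPin} {S : Set Constraint} {o m : ℕ} {s : PartialInstance}
  {H : (ℕ → Bool) → ℝ≥0} {C : ℝ≥0}

lemma addCopy (h : s.Represents o H C) (hs : s.Valid G S o) {x y : ℕ} (hx : x < o) (hy : y < o) :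
    (G.addCopy o x y s).Represents o (fun σ => softImp G.ratio (σ x) (σ y) * H σ)
      (s.tag * (s.tag + 1) * G.base * G.base * C) := by
  refine ⟨?_, fun σ hσ => ?_, fun σ hσ => ?_⟩
  · have := G.base_pos
    have := h.pos
    have := one_pos.trans hs.one_lt_tag
    positivity
  · simp only [SupermodularPin.addCopy, weight_append, G.weight_link _ _ _ _ _ hσ]
    calc _ ≤ s.tag * (s.tag + 1) * G.base * G.base * softImp G.ratio (σ x) (σ y) * (C * H σ) := by
          gcongr
          · exact softImp_mul_le G.ratio_lt_one.le _ _ _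
          · exact h.le σ hσ
      _ = _ := by ring
  · obtain ⟨τ, hτσ, hτ⟩ := h.attained σ hσ
    have hfresh := hs.lt_fresh
    have hext : ∀ i ≤ o, Function.update τ s.fresh (σ y) i = σ i := fun i hi => by
      rw [Function.update_of_ne (by omega), hτσ i hi]
    have hold : weight s.applications (Function.update τ s.fresh (σ y)) = C * H σ :=
      (weight_congr fun c hc j => Function.update_of_ne (hs.scope_lt c hc j).ne _ _).trans hτ
    refine ⟨_, hext, ?_⟩
    simp only [SupermodularPin.addCopy, weight_append, hold,
      G.weight_link x y o s.fresh s.tag ((hext o le_rfl).trans hσ), hext x hx.le, hext y hy.le,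
      Function.update_self, softImp_self]
    ring

lemma addCopies (h : s.Represents o H C) (hs : s.Valid G S o) (hG : G.con ∈ S) (hU : Unary ⊆ S)
    (m : ℕ) {x y : ℕ} (hx : x < o) (hy : y < o) :
    ∃ C', (G.addCopies o m x y s).Represents o
      (fun σ => softImp (G.ratio ^ m) (σ x) (σ y) * H σ) C' := by
  simp only [← softImp_pow]
  induction m generalizing s H C with
  | zero => exact ⟨C, by simpa [SupermodularPin.addCopies] using h⟩
  | succ m ih =>
    have hs' := hs.addCopy hG hU (hx.trans hs.lt_fresh) (hy.trans hs.lt_fresh)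
    simpa only [pow_succ, mul_assoc, SupermodularPin.addCopies_succ] using
      ih (h.addCopy hs hx hy) hs'

lemma addAll (h : s.Represents o H C) (hs : s.Valid G S o) (hG : G.con ∈ S) (hU : Unary ⊆ S)
    {l : List (ℕ × ℕ)} (hl : ∀ p ∈ l, p.1 < o ∧ p.2 < o) :
    ∃ C', (G.addAll o m l s).Represents o (fun σ => softWeight (G.ratio ^ m) l σ * H σ) C' := by
  induction l generalizing s H C with
  | nil => exact ⟨C, by simpa [SupermodularPin.addAll, softWeight] using h⟩
  | cons p l ih =>
    obtain ⟨hp₁, hp₂⟩ := hl p List.mem_cons_self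
    obtain ⟨C₁, h₁⟩ := h.addCopies hs hG hU m hp₁ hp₂
    have hs₁ := hs.addCopies hG hU m (hp₁.trans hs.lt_fresh) (hp₂.trans hs.lt_fresh)
    obtain ⟨C₂, h₂⟩ : ∃ C₂, (G.addAll o m (p :: l) s).Represents o _ C₂ :=
      ih h₁ hs₁ fun q hq => hl q (List.mem_cons_of_mem p hq)
    refine ⟨C₂, ?_⟩
    simpa only [softWeight, List.map_cons, List.prod_cons, mul_comm (softImp _ _ _), mul_assoc]
      using h₂

end PartialInstance.Represents

/-! ### Separating the implications from the other constraints -/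

/-- The values of `Implies`, by which the machine recognises it. -/
def impTable : List ℝ := [1, 1, 0, 1]

lemma table_implies : Implies.table = impTable := by
  simp [Constraint.table, Implies, points, impTable, table2]

lemma length_points (k : ℕ) : (points k).length = 2 ^ k := by
  induction k with
  | zero => rfl
  | succ k ih => simp [points, ih, pow_succ, mul_two]

lemma eq_of_table_eq {f g : Constraint} (h : f.table = g.table) : f = g := by
  obtain ⟨k, f⟩ := f
  obtain ⟨l, g⟩ := g
  obtain rfl : k = l := by
    simpa [Constraint.table, length_points] using congrArg List.length h
  congr 1
  funext x
  exact_mod_cast List.map_inj_left.1 h x (mem_points k x)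

lemma eq_implies_of_table_eq {f : Constraint} (h : f.table = impTable) : f = Implies :=
  eq_of_table_eq (h.trans table_implies.symm)

/-- The first two variables of an application. -/
def Application.pair (c : Application) : ℕ × ℕ :=
  ((List.ofFn c.scope).getD 0 0, (List.ofFn c.scope).getD 1 0)

open Classical in
/-- The applications of other constraints than `Implies`, last first. -/
def others (L : List Application) : List Application :=
  (L.filter fun c => c.con.table ≠ impTable).reverse

open Classical in
/-- The pairs to which `Implies` is applied, last first. -/
def impPairs (L : List Application) : List (ℕ × ℕ) :=
  ((L.filter fun c => c.con.table = impTable).map Application.pair).reverse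

section

variable {c : Application} {L : List Application}

lemma others_cons_of_ne (h : c.con.table ≠ impTable) : others (c :: L) = others L ++ [c] := by
  simp [others, h]

lemma others_cons_of_eq (h : c.con.table = impTable) : others (c :: L) = others L := by
  simp [others, h]

lemma impPairs_cons_of_ne (h : c.con.table ≠ impTable) : impPairs (c :: L) = impPairs L := by
  simp [impPairs, h]

lemma impPairs_cons_of_eq (h : c.con.table = impTable) :
    impPairs (c :: L) = impPairs L ++ [c.pair] := by
  simp [impPairs, h]

lemma mem_others : c ∈ others L ↔ c ∈ L ∧ c.con.table ≠ impTable := by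
  simp [others]

lemma nodup_others (hL : L.Nodup) : (others L).Nodup := List.nodup_reverse.2 (hL.filter _)

lemma length_impPairs_le (L : List Application) : (impPairs L).length ≤ L.length := by
  simpa [impPairs] using List.length_filter_le _ L

lemma impPairs_lt {n : ℕ} (hL : ∀ c ∈ L, ∀ j, c.scope j < n) :
    ∀ p ∈ impPairs L, p.1 < n ∧ p.2 < n := by
  intro p hp
  simp only [impPairs, List.mem_reverse, List.mem_map, List.mem_filter, decide_eq_true_eq] at hp
  obtain ⟨⟨f, u⟩, ⟨hc, ht⟩, rfl⟩ := hp
  obtain rfl := eq_implies_of_table_eq ht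
  exact ⟨hL _ hc (0 : Fin 2), hL _ hc (1 : Fin 2)⟩

lemma Application.eval_of_table_eq (h : c.con.table = impTable) (σ : ℕ → Bool) :
    c.eval σ = softImp 0 (σ c.pair.1) (σ c.pair.2) := by
  obtain ⟨f, u⟩ := c
  obtain rfl := eq_implies_of_table_eq h
  rfl

lemma weight_others_cons_of_ne (h : c.con.table ≠ impTable) (σ : ℕ → Bool) :
    weight (others (c :: L)) σ = c.eval σ * weight (others L) σ := by
  rw [others_cons_of_ne h, weight_append, mul_comm]
  simp [weight]

lemma weight_eq_softWeight_mul (L : List Application) (σ : ℕ → Bool) :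
    weight L σ = softWeight 0 (impPairs L) σ * weight (others L) σ := by
  induction L with
  | nil => simp [weight, softWeight, impPairs, others]
  | cons c L ih =>
    rw [weight_cons, ih]
    by_cases h : c.con.table = impTable
    · rw [others_cons_of_eq h, impPairs_cons_of_eq h, c.eval_of_table_eq h]
      simp only [softWeight, List.map_append, List.prod_append, List.map_cons, List.map_nil,
        List.prod_cons, List.prod_nil]
      ring
    · rw [weight_others_cons_of_ne h, impPairs_cons_of_ne h, mul_left_comm]

end

/-- A bound for the values of a constraint and for the inverses of its nonzero values that can be
computed from the table by field operations; `0⁻¹ = 0` makes it meaningful at zeros as well. -/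
def Constraint.spread (f : Constraint) : ℝ≥0 :=
  ((points f.arity).map fun x => 1 + f.val x + (f.val x)⁻¹).prod

namespace Constraint

variable (f : Constraint)

lemma one_le_spread : 1 ≤ f.spread := by
  refine List.one_le_prod fun a ha => ?_
  obtain ⟨x, -, rfl⟩ := List.mem_map.1 ha
  exact le_add_right le_self_add

lemma le_spread (x : Fin f.arity → Bool) : 1 + f.val x + (f.val x)⁻¹ ≤ f.spread := by
  refine List.single_le_prod (fun a ha => ?_) _ (List.mem_map.2 ⟨x, mem_points _ x, rfl⟩)
  obtain ⟨y, -, rfl⟩ := List.mem_map.1 ha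
  exact le_add_right le_self_add

lemma val_le_spread (x : Fin f.arity → Bool) : f.val x ≤ f.spread :=
  (le_add_right le_add_self).trans (f.le_spread x)

lemma one_le_spread_mul_val {x : Fin f.arity → Bool} (h : f.val x ≠ 0) : 1 ≤ f.spread * f.val x :=
  calc 1 = (f.val x)⁻¹ * f.val x := (inv_mul_cancel₀ h).symm
    _ ≤ _ := by
      gcongr
      exact le_add_self.trans (f.le_spread x)

end Constraint

/-- The product of the spreads of all constraints. It bounds the measure and the inverse of every
nonzero measure. -/
def totalSpread (L : List Application) : ℝ≥0 := (L.map fun c => c.con.spread).prod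

lemma totalSpread_cons (c : Application) (L : List Application) :
    totalSpread (c :: L) = c.con.spread * totalSpread L := by
  simp [totalSpread]

lemma one_le_totalSpread (L : List Application) : 1 ≤ totalSpread L := by
  refine List.one_le_prod fun a ha => ?_
  obtain ⟨c, -, rfl⟩ := List.mem_map.1 ha
  exact c.con.one_le_spread

lemma val_le_totalSpread {L : List Application} {c : Application} (hc : c ∈ L)
    (x : Fin c.con.arity → Bool) : c.con.val x ≤ totalSpread L := by
  refine (c.con.val_le_spread x).trans
    (List.single_le_prod (fun a ha => ?_) _ (List.mem_map.2 ⟨c, hc, rfl⟩))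
  obtain ⟨d, -, rfl⟩ := List.mem_map.1 ha
  exact d.con.one_le_spread

lemma weight_others_le (L : List Application) (σ : ℕ → Bool) :
    weight (others L) σ ≤ totalSpread L := by
  induction L with
  | nil => simp [others, weight, totalSpread]
  | cons c L ih =>
    rw [totalSpread_cons]
    by_cases h : c.con.table = impTable
    · rw [others_cons_of_eq h]
      exact ih.trans (le_mul_of_one_le_left' c.con.one_le_spread)
    · rw [weight_others_cons_of_ne h]
      exact mul_le_mul' (c.con.val_le_spread _) ih

lemma one_le_totalSpread_mul {L : List Application} {σ : ℕ → Bool} (h0 : weight (others L) σ ≠ 0) :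
    1 ≤ totalSpread L * weight (others L) σ := by
  induction L with
  | nil => simp [others, weight, totalSpread]
  | cons c L ih =>
    rw [totalSpread_cons]
    by_cases h : c.con.table = impTable
    · rw [others_cons_of_eq h] at h0 ⊢
      rw [mul_assoc]
      exact one_le_mul c.con.one_le_spread (ih h0)
    · rw [weight_others_cons_of_ne h] at h0 ⊢
      rw [mul_mul_mul_comm]
      exact one_le_mul (c.con.one_le_spread_mul_val (left_ne_zero_of_mul h0))
        (ih (right_ne_zero_of_mul h0))

section

variable {p : List (ℕ × ℕ)} {σ : ℕ → Bool} {l : ℝ≥0}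

lemma softWeight_of_ne_zero (h : softWeight 0 p σ ≠ 0) (l : ℝ≥0) : softWeight l p σ = 1 := by
  rw [softWeight, ne_eq, List.prod_eq_zero_iff, List.mem_map] at h
  push Not at h
  refine List.prod_eq_one fun a ha => ?_
  obtain ⟨q, hq, rfl⟩ := List.mem_map.1 ha
  exact softImp_of_ne_zero (h q hq) l

lemma softWeight_le_of_eq_zero (h : softWeight 0 p σ = 0) (hl : l ≤ 1) : softWeight l p σ ≤ l := by
  rw [softWeight, List.prod_eq_zero_iff, List.mem_map] at h
  obtain ⟨q, hq, h⟩ := h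
  rw [softWeight, ((List.perm_cons_erase hq).map _).prod_eq, List.map_cons, List.prod_cons,
    softImp_of_eq_zero h]
  refine mul_le_of_le_one_right' ((List.prod_le_pow_card _ 1 fun a ha => ?_).trans_eq (one_pow _))
  obtain ⟨r, -, rfl⟩ := List.mem_map.1 ha
  exact softImp_le_one hl _ _

/-- Violating an implication costs the factor `l`, which exceeds what the other constraints can make
up for, by more than the factor `2`. -/
lemma softWeight_ne_zero_of_le {Z K a b : ℝ≥0} (hl : l ≤ 1) (hZ : l * (Z * Z) < 1 / 2) (hK : K < 2)
    (ha : 1 ≤ Z * a) (hb : b ≤ Z) (h : a ≤ K * (softWeight l p σ * b)) : softWeight 0 p σ ≠ 0 := by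
  intro hzero
  have ha0 : 0 < a := pos_iff_ne_zero.2 (right_ne_zero_of_mul (one_pos.trans_le ha).ne')
  refine lt_irrefl a ?_
  calc a ≤ K * (softWeight l p σ * b) := h
    _ ≤ K * (l * Z) := by
      gcongr
      exact softWeight_le_of_eq_zero hzero hl
    _ ≤ K * (l * Z * (Z * a)) := mul_le_mul' le_rfl (le_mul_of_one_le_right' ha)
    _ = K * (l * (Z * Z) * a) := by ring
    _ ≤ K * (1 / 2 * a) := by gcongr
    _ < 2 * (1 / 2 * a) := by gcongr
    _ = a := by rw [← mul_assoc, mul_one_div_cancel two_ne_zero, one_mul]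

end

/-! ### The instance produced by the reduction -/

namespace SupermodularPin

variable (G : SupermodularPin)

/-- The constraints other than `Implies`, and a variable `n` forced to be `false`. -/
def initial (n : ℕ) (L : List Application) : PartialInstance :=
  ⟨unaryApp 1 0 n :: others L, n + 1, totalSpread L + G.base⟩

/-- The instance in which every implication is replaced by `m` links. -/
def result (n m : ℕ) (L : List Application) : PartialInstance :=
  G.addAll n m (impPairs L) (G.initial n L)

variable {n m : ℕ} {L : List Application}

lemma initial_valid {S : Set Constraint} (hL : L.Nodup) (hn : ∀ c ∈ L, ∀ j, c.scope j < n)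
    (hS : ∀ c ∈ L, c.con ≠ Implies → c.con ∈ S) (hU : Unary ⊆ S) : (G.initial n L).Valid G S n where
  nodup :=
    .cons (fun h => lt_irrefl n (hn _ (mem_others.1 h).1 (0 : Fin 1))) (nodup_others hL)
  scope_lt := List.forall_mem_cons.2 ⟨fun _ => Nat.lt_succ_self n, fun c hc j =>
    (hn c (mem_others.1 hc).1 j).trans (Nat.lt_succ_self n)⟩
  val_false_lt := List.forall_mem_cons.2
    ⟨by simpa [unaryApp, initial] using lt_add_of_le_of_pos (one_le_totalSpread L) G.base_pos,
      fun c hc => lt_add_of_le_of_pos (val_le_totalSpread (mem_others.1 hc).1 _) G.base_pos⟩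
  con_mem := List.forall_mem_cons.2 ⟨hU rfl, fun c hc =>
    hS c (mem_others.1 hc).1 fun h => (mem_others.1 hc).2 (h ▸ table_implies)⟩
  lt_fresh := Nat.lt_succ_self n
  one_lt_tag := lt_add_of_le_of_pos (one_le_totalSpread L) G.base_pos
  base_lt_tag := lt_add_of_pos_left _ (one_pos.trans_le (one_le_totalSpread L))

lemma initial_represents : (G.initial n L).Represents n (weight (others L)) 1 := by
  have hweight (σ : ℕ → Bool) (hσ : σ n = false) :
      weight (G.initial n L).applications σ = 1 * weight (others L) σ := by
    simp [initial, weight_cons, unaryApp_eval, hσ]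
  exact ⟨one_pos, fun σ hσ => (hweight σ hσ).le, fun σ hσ => ⟨σ, fun _ _ => rfl, hweight σ hσ⟩⟩

lemma result_valid {S : Set Constraint} (hG : G.con ∈ S) (hU : Unary ⊆ S) (hL : L.Nodup)
    (hn : ∀ c ∈ L, ∀ j, c.scope j < n) (hS : ∀ c ∈ L, c.con ≠ Implies → c.con ∈ S) :
    (G.result n m L).Valid G S n :=
  (G.initial_valid hL hn hS hU).addAll hG hU m fun p hp =>
    (impPairs_lt hn p hp).imp (·.trans (Nat.lt_succ_self n)) (·.trans (Nat.lt_succ_self n))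

lemma exists_result_represents (hL : L.Nodup) (hn : ∀ c ∈ L, ∀ j, c.scope j < n) :
    ∃ C, (G.result n m L).Represents n
      (fun σ => softWeight (G.ratio ^ m) (impPairs L) σ * weight (others L) σ) C :=
  G.initial_represents.addAll
    (G.initial_valid (S := Set.univ) hL hn (fun _ _ _ => trivial) (Set.subset_univ _))
    trivial (Set.subset_univ _) (impPairs_lt hn)

lemma applications_subset_addCopies (o m x y : ℕ) (s : PartialInstance) :
    s.applications ⊆ (G.addCopies o m x y s).applications := by
  induction m generalizing s with
  | zero => exact List.Subset.refl _
  | succ _ ih => exact fun c hc => ih (G.addCopy o x y s) (List.mem_append_right _ hc)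

lemma applications_subset_addAll (o m : ℕ) (l : List (ℕ × ℕ)) (s : PartialInstance) :
    s.applications ⊆ (G.addAll o m l s).applications := by
  induction l generalizing s with
  | nil => exact List.Subset.refl _
  | cons p l ih => exact List.Subset.trans (G.applications_subset_addCopies _ _ _ _ _) (ih _)

lemma eq_false_of_weight_result_ne_zero {σ : ℕ → Bool}
    (h : weight (G.result n m L).applications σ ≠ 0) : σ n = false := by
  by_contra hσ
  refine h (List.prod_eq_zero (List.mem_map.2 ⟨unaryApp 1 0 n, ?_, ?_⟩))
  · exact G.applications_subset_addAll _ _ _ _ List.mem_cons_self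
  · simp [unaryApp_eval, hσ]

lemma weight_le_of_weight_result_le (hL : L.Nodup) (hn : ∀ c ∈ L, ∀ j, c.scope j < n)
    (hm : G.ratio ^ m * (totalSpread L * totalSpread L) < 1 / 2) {K : ℝ≥0} (hK : K < 2)
    {σ : ℕ → Bool}
    (hσ : ∀ τ, weight (G.result n m L).applications τ ≤ K * weight (G.result n m L).applications σ)
    (τ : ℕ → Bool) : weight L τ ≤ K * weight L σ := by
  by_cases hτ : weight L τ = 0
  · exact hτ ▸ zero_le
  obtain ⟨C, hC⟩ := G.exists_result_represents (m := m) hL hn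
  have hρ : weight L (Function.update τ n false) = weight L τ :=
    weight_congr fun c hc j => Function.update_of_ne (hn c hc j).ne _ _
  rw [← hρ] at hτ ⊢
  have hρn : Function.update τ n false n = false := Function.update_self ..
  generalize Function.update τ n false = ρ at *
  rw [weight_eq_softWeight_mul] at hτ
  have hρ_satisfies := softWeight_of_ne_zero (left_ne_zero_of_mul hτ)
  obtain ⟨ρ', -, hρ'⟩ := hC.attained ρ hρn
  have hCρ : C * weight (others L) ρ ≤ K * weight (G.result n m L).applications σ := by
    simpa only [hρ', hρ_satisfies, one_mul] using hσ ρ'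
  have hσn : σ n = false := G.eq_false_of_weight_result_ne_zero <| right_ne_zero_of_mul
    ((mul_pos hC.pos (pos_iff_ne_zero.2 (right_ne_zero_of_mul hτ))).trans_le hCρ).ne'
  have hle : weight (others L) ρ ≤
      K * (softWeight (G.ratio ^ m) (impPairs L) σ * weight (others L) σ) := by
    refine le_of_mul_le_mul_left ((hCρ.trans (mul_le_mul' le_rfl (hC.le σ hσn))).trans_eq ?_) hC.pos
    ring
  have hσ_satisfies := softWeight_of_ne_zero <|
    softWeight_ne_zero_of_le (pow_le_one₀ zero_le G.ratio_lt_one.le) hm hK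
      (one_le_totalSpread_mul (right_ne_zero_of_mul hτ)) (weight_others_le L σ) hle
  simpa only [weight_eq_softWeight_mul L, hρ_satisfies, hσ_satisfies, one_mul] using hle

end SupermodularPin

/-! ### Instances and approximate solutions -/

/-- An application in an instance, with its number of variables forgotten. -/
def Applied.toApplication {n : ℕ} (c : Applied n) : Application := ⟨c.con, fun j => c.scope j⟩

lemma Applied.toApplication_injective {n : ℕ} :
    Function.Injective (Applied.toApplication : Applied n → Application) := by
  rintro ⟨f, u⟩ ⟨g, v⟩ h
  simp only [Applied.toApplication, Application.mk.injEq] at h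
  obtain ⟨rfl, h⟩ := h
  congr 1
  funext j
  exact Fin.ext (congrFun (eq_of_heq h) j)

/-- The truth assignment given by a bit string, extended by `false`. -/
def assignment (y : List Bool) : ℕ → Bool := fun i => y.getD i false

/-- The first `n` bits of a string, filled up with `false`. -/
def firstBits (n : ℕ) (y : List Bool) : List Bool := List.ofFn fun i : Fin n => y.getD i false

lemma length_firstBits (n : ℕ) (y : List Bool) : (firstBits n y).length = n := List.length_ofFn

lemma assignment_firstBits {n i : ℕ} (hi : i < n) (y : List Bool) :
    assignment (firstBits n y) i = assignment y i := by
  simp [assignment, firstBits, hi]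

lemma assignment_ofFn {n i : ℕ} (hi : i < n) (σ : ℕ → Bool) :
    assignment (List.ofFn fun j : Fin n => σ j) i = σ i := by
  simp [assignment, hi]

namespace CSPInst

variable {F : Set Constraint} (x : CSPInst F)

/-- The applications of an instance. -/
def applications : List Application := x.cons.map Applied.toApplication

lemma nodup_applications : x.applications.Nodup := x.nodup.map Applied.toApplication_injective

lemma con_mem_of_mem_applications : ∀ c ∈ x.applications, c.con ∈ F := by
  intro c hc
  obtain ⟨d, hd, rfl⟩ := List.mem_map.1 hc
  exact x.mem d hd

lemma scope_lt_of_mem_applications : ∀ c ∈ x.applications, ∀ j, c.scope j < x.n := by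
  intro c hc
  obtain ⟨d, -, rfl⟩ := List.mem_map.1 hc
  exact fun j => (d.scope j).2

lemma code_eq : x.code = List.replicate x.n 1 ++ -1 :: x.applications.flatMap Application.code := by
  simp only [code, applications, List.flatMap_map]
  rfl

lemma meas_eq_weight {y : List Bool} (hy : y.length = x.n) :
    (maxProdCSP F).meas x y = weight x.applications (assignment y) := by
  simp only [maxProdCSP, dif_pos hy, value, weight, applications, List.map_map]
  refine congrArg List.prod (List.map_congr_left fun c _ => congrArg c.con.val ?_)
  funext j
  exact (List.getD_eq_getElem _ _ ((c.scope j).2.trans_eq hy.symm)).symm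

lemma exists_meas_eq_weight (σ : ℕ → Bool) :
    ∃ y ∈ (maxProdCSP F).sol x, (maxProdCSP F).meas x y = weight x.applications σ := by
  refine ⟨List.ofFn fun i : Fin x.n => σ i, List.length_ofFn, ?_⟩
  rw [x.meas_eq_weight List.length_ofFn]
  exact weight_congr fun c hc j => assignment_ofFn (x.scope_lt_of_mem_applications c hc j) σ

lemma exists_isGreatest_meas :
    ∃ v, IsGreatest ((maxProdCSP F).meas x '' (maxProdCSP F).sol x) v := by
  have hfin : ((maxProdCSP F).meas x '' (maxProdCSP F).sol x).Finite :=
    (List.finite_length_eq Bool x.n).image _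
  obtain ⟨y, hy, -⟩ := x.exists_meas_eq_weight fun _ => false
  obtain ⟨v, hv⟩ := hfin.exists_maximal ⟨_, y, hy, rfl⟩
  exact ⟨v, hv.1, fun u hu => (le_total u v).elim id fun h => hv.2 hu h⟩

lemma isApprox_iff {K : ℝ≥0} (hK : 1 ≤ K) {y : List Bool} :
    (maxProdCSP F).IsApprox K x y ↔ y.length = x.n ∧
      ∀ τ, weight x.applications τ ≤ K * weight x.applications (assignment y) := by
  have hK0 : (0 : ℝ) < K := by exact_mod_cast one_pos.trans_le hK
  have one_div_le_iff {m v : ℝ≥0} (hv : v ≠ 0) : 1 / (K : ℝ) ≤ m / v ↔ v ≤ K * m := by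
    rw [div_le_div_iff₀ hK0 (by exact_mod_cast pos_iff_ne_zero.2 hv), one_mul, mul_comm]
    exact_mod_cast Iff.rfl
  constructor
  · rintro ⟨hy, v, hv, -, happrox⟩
    refine ⟨hy, fun τ => ?_⟩
    obtain ⟨z, hz, hτ⟩ := x.exists_meas_eq_weight τ
    rw [← x.meas_eq_weight hy, ← hτ]
    refine (hv.2 ⟨z, hz, rfl⟩).trans ?_
    by_cases hv0 : v = 0
    · exact hv0 ▸ zero_le
    · exact (one_div_le_iff hv0).1 (happrox hv0).1
  · rintro ⟨hy, h⟩
    obtain ⟨v, hv⟩ := x.exists_isGreatest_meas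
    have hle : (maxProdCSP F).meas x y ≤ v := hv.2 ⟨y, hy, rfl⟩
    refine ⟨hy, v, hv, fun hv0 => le_antisymm (hv0 ▸ hle) zero_le, fun hv0 => ⟨?_, ?_⟩⟩
    · obtain ⟨z, hz, rfl⟩ := hv.1
      rw [one_div_le_iff hv0, x.meas_eq_weight hz, x.meas_eq_weight hy]
      exact h _
    · exact (div_le_one_of_le₀ (by exact_mod_cast hle) v.2).trans (by exact_mod_cast hK)

end CSPInst

namespace PartialInstance

variable {G : SupermodularPin} {S : Set Constraint} {o : ℕ} (s : PartialInstance)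
  (h : s.Valid G S o)

/-- The instance formed by a valid list of applications. -/
def toInst : CSPInst S where
  n := s.fresh
  cons := s.applications.pmap (fun c hc => ⟨c.con, fun j => ⟨c.scope j, hc j⟩⟩) h.scope_lt
  nodup := h.nodup.pmap fun _ _ _ _ he => by
    have hforget := congrArg Applied.toApplication he
    exact hforget
  mem c hc := by
    obtain ⟨d, hd, rfl⟩ := List.mem_pmap.1 hc
    exact h.con_mem d hd

lemma applications_toInst : (s.toInst h).applications = s.applications := by
  simp only [CSPInst.applications, toInst, List.map_pmap, Applied.toApplication]
  exact (List.pmap_eq_map h.scope_lt).trans (List.map_id' _)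

lemma code_toInst : (s.toInst h).code =
    List.replicate s.fresh 1 ++ -1 :: s.applications.flatMap Application.code := by
  rw [CSPInst.code_eq, applications_toInst]
  rfl

end PartialInstance

namespace SupermodularPin

variable (G : SupermodularPin) {F S : Set Constraint} (x : CSPInst F) {m : ℕ}

lemma result_applications_valid (hG : G.con ∈ S) (hU : Unary ⊆ S)
    (hF : ∀ c ∈ F, c ≠ Implies → c ∈ S) : (G.result x.n m x.applications).Valid G S x.n :=
  G.result_valid hG hU x.nodup_applications x.scope_lt_of_mem_applications fun c hc =>
    hF _ (x.con_mem_of_mem_applications c hc)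

lemma isApprox_firstBits (h : (G.result x.n m x.applications).Valid G S x.n)
    (hm : G.ratio ^ m * (totalSpread x.applications * totalSpread x.applications) < 1 / 2)
    {K : ℝ≥0} (hK : 1 ≤ K) (hK2 : K < 2) {y : List Bool}
    (hy : (maxProdCSP S).IsApprox K (PartialInstance.toInst _ h) y) :
    (maxProdCSP F).IsApprox K x (firstBits x.n y) := by
  rw [CSPInst.isApprox_iff _ hK, PartialInstance.applications_toInst] at hy
  refine (x.isApprox_iff hK).2 ⟨length_firstBits _ _, fun τ => ?_⟩
  rw [weight_congr fun c hc j =>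
    assignment_firstBits (x.scope_lt_of_mem_applications c hc j) y]
  exact G.weight_le_of_weight_result_le x.nodup_applications x.scope_lt_of_mem_applications
    hm hK2 hy.2 τ

end SupermodularPin

/-! ### Lengths of numbers -/

lemma one_le_len (r : ℝ) : 1 ≤ len r := Nat.le_add_right 1 _

lemma len_le_of_bounds {r : ℝ} {N : ℕ} (h0 : 0 < r) (h1 : 1 ≤ r * 2 ^ N) (h2 : r ≤ 2 ^ N) :
    len r ≤ N + 1 := by
  have hupper : Real.logb 2 r ≤ N := by
    rw [Real.logb_le_iff_le_rpow one_lt_two h0]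
    exact_mod_cast h2
  have hlower : -(N : ℝ) ≤ Real.logb 2 r := by
    rw [Real.le_logb_iff_rpow_le one_lt_two h0, Real.rpow_neg zero_le_two, Real.rpow_natCast,
      inv_le_iff_one_le_mul₀ (by positivity)]
    exact h1
  rw [len, add_comm]
  exact Nat.succ_le_succ (Nat.ceil_le.2 (abs_le.2 ⟨hlower, hupper⟩))

lemma len_le_of_one_le {r : ℝ} {N : ℕ} (h1 : 1 ≤ r) (h2 : r ≤ 2 ^ N) : len r ≤ N + 1 :=
  len_le_of_bounds (one_pos.trans_le h1)
    (one_le_mul_of_one_le_of_one_le h1 (one_le_pow₀ one_le_two)) h2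

lemma two_mul_le_two_pow_len {r : ℝ} (h : 0 < r) : 2 * r ≤ 2 ^ len r := by
  have hlog : Real.logb 2 (2 * r) ≤ len r := by
    rw [Real.logb_mul two_ne_zero h.ne', Real.logb_self_eq_one one_lt_two, len, Nat.cast_add,
      Nat.cast_one]
    gcongr
    exact (le_abs_self _).trans (Nat.le_ceil _)
  rw [Real.logb_le_iff_le_rpow one_lt_two (by positivity)] at hlog
  exact_mod_cast hlog

lemma len_inv (r : ℝ) : len r⁻¹ = len r := by
  simp [len, Real.logb_inv]

/-- The factor by which a table entry enters the spread, in the form in which the machine computes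
it. -/
def growth (r : ℝ) : ℝ := r + (1 + 1 / r)

lemma one_le_growth {r : ℝ} (h : 0 ≤ r) : 1 ≤ growth r := by
  have : 0 ≤ 1 / r := by positivity
  simp only [growth]
  linarith

lemma growth_le {r : ℝ} (h : 0 ≤ r) : growth r ≤ 4 ^ len r := by
  have hlen : (2 : ℝ) ≤ 2 ^ len r :=
    le_self_pow₀ one_le_two (Nat.one_le_iff_ne_zero.1 (one_le_len r))
  have hpow : (4 : ℝ) ^ len r = 2 ^ len r * 2 ^ len r := by rw [← mul_pow]; norm_num
  rw [hpow, growth, one_div]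
  rcases h.eq_or_lt with rfl | h
  · rw [inv_zero]
    nlinarith
  · have hr := two_mul_le_two_pow_len h
    have hinv := two_mul_le_two_pow_len (inv_pos.2 h)
    rw [len_inv] at hinv
    nlinarith

/-! ### Deterministic computations -/

/-- A step that involves neither coins nor the oracle. -/
structure DetStep (a b : Config) : Prop where
  step_eq : ∀ M, step M a = PMF.pure b
  ne_query : ∀ q x k, a.todo ≠ .query q x :: k

/-- `DetPath n a b`: a deterministic computation of `n` steps leads from `a` to `b`. -/
inductive DetPath : ℕ → Config → Config → Prop
  | refl (a : Config) : DetPath 0 a a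
  | head {n : ℕ} {a b c : Config} : DetStep a b → DetPath n b c → DetPath (n + 1) a c

lemma DetPath.trans {n m : ℕ} {a b c : Config} (hab : DetPath n a b) (hbc : DetPath m b c) :
    DetPath (n + m) a c := by
  induction hab with
  | refl => simpa using hbc
  | @head n _ _ _ hstep _ ih =>
    rw [Nat.add_right_comm]
    exact .head hstep (ih hbc)

lemma run_add (M : Oracle) (c : Config) (s t : ℕ) :
    run M c (s + t) = (run M c s).bind fun d => run M d t := by
  induction t with
  | zero => simp [run]
  | succ t ih =>
    change (run M c (s + t)).bind (step M) = _
    rw [ih, PMF.bind_bind]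
    rfl

lemma run_one (M : Oracle) (c : Config) : run M c 1 = step M c := by
  simp [run]

lemma run_of_todo_eq_nil (M : Oracle) {c : Config} (h : c.todo = []) (t : ℕ) :
    run M c t = PMF.pure c := by
  induction t with
  | zero => rfl
  | succ t ih =>
    simp only [run, ih, PMF.pure_bind]
    obtain ⟨todo, store, clock⟩ := c
    subst h
    rfl

lemma DetStep.run_add_one (M : Oracle) {a b : Config} (h : DetStep a b) (t : ℕ) :
    run M a (t + 1) = run M b t := by
  rw [Nat.add_comm, run_add, run_one, h.step_eq M, PMF.pure_bind]

lemma DetPath.run_add (M : Oracle) {n : ℕ} {a b : Config} (h : DetPath n a b) (t : ℕ) :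
    run M a (n + t) = run M b t := by
  induction h with
  | refl => rw [Nat.zero_add]
  | head hstep _ ih => rw [Nat.add_right_comm, hstep.run_add_one, ih]

lemma DetPath.ne_query_of_lt (M : Oracle) {n : ℕ} {a b : Config} (h : DetPath n a b) :
    ∀ t < n, ∀ c ∈ (run M a t).support, ∀ q x k, c.todo ≠ .query q x :: k := by
  induction h with
  | refl => exact fun t ht => absurd ht t.not_lt_zero
  | head hstep _ ih =>
    rintro (- | t) ht c hc
    · obtain rfl : c = _ := by simpa only [run, PMF.support_pure, Set.mem_singleton_iff] using hc
      exact hstep.ne_query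
    · rw [hstep.run_add_one] at hc
      exact ih t (Nat.lt_of_succ_lt_succ ht) c hc

/-- `Runs B P s s' c`: the program `P` turns the store `s` into `s'` deterministically, with time
and number of steps at most `c * (B + 1)`. Here `B + 1` is meant to bound the length of every
number that `P` writes; it is the length of `2 ^ B`. -/
def Runs (B : ℕ) (P : Prog) (s s' : Store) (c : ℕ) : Prop :=
  ∀ k t₀, ∃ n t₁, n ≤ c * (B + 1) ∧ t₁ ≤ t₀ + c * (B + 1) ∧
    DetPath n ⟨P :: k, s, t₀⟩ ⟨k, s', t₁⟩

section Runs

variable {B : ℕ} {P Q R : Prog} {s s' s'' : Store} {c d : ℕ} {t : Test}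

lemma Runs.mono (h : Runs B P s s' c) (hcd : c ≤ d) : Runs B P s s' d := by
  intro k t₀
  obtain ⟨n, t₁, hn, ht, hpath⟩ := h k t₀
  have := Nat.mul_le_mul_right (B + 1) hcd
  exact ⟨n, t₁, by omega, by omega, hpath⟩

lemma runs_one (hd : d ≤ B + 1) (h : ∀ k t, DetStep ⟨P :: k, s, t⟩ ⟨k, s', t + d⟩) :
    Runs B P s s' 1 :=
  fun k t => ⟨1, t + d, by omega, by omega, .head (h k t) (.refl _)⟩

lemma Runs.of_step (h : ∀ k t, DetStep ⟨P :: k, s, t⟩ ⟨Q :: k, s, t + 1⟩) (hQ : Runs B Q s s' c) :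
    Runs B P s s' (c + 1) := by
  intro k t₀
  obtain ⟨n, t₁, hn, ht, hpath⟩ := hQ k (t₀ + 1)
  exact ⟨n + 1, t₁, by grind, by grind, .head (h k t₀) hpath⟩

lemma Runs.of_step_seq (h : ∀ k t, DetStep ⟨R :: k, s, t⟩ ⟨P :: Q :: k, s, t + 1⟩)
    (hP : Runs B P s s' c) (hQ : Runs B Q s' s'' d) : Runs B R s s'' (c + d + 1) := by
  intro k t₀
  obtain ⟨n, t₁, hn, ht, hpath⟩ := hP (Q :: k) (t₀ + 1)
  obtain ⟨m, t₂, hm, ht', hpath'⟩ := hQ k t₁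
  exact ⟨n + m + 1, t₂, by grind, by grind, .head (h k t₀) (hpath.trans hpath')⟩

lemma Runs.seq (hP : Runs B P s s' c) (hQ : Runs B Q s' s'' d) :
    Runs B (.seq P Q) s s'' (c + d + 1) :=
  .of_step_seq (fun _ _ => ⟨fun _ => rfl, by simp⟩) hP hQ

lemma Runs.branch_pos (ht : t.Holds s) (hP : Runs B P s s' c) :
    Runs B (.branch t P Q) s s' (c + 1) :=
  .of_step (fun _ _ => ⟨fun _ => by simp [step, ht], by simp⟩) hP

lemma Runs.branch_neg (ht : ¬ t.Holds s) (hQ : Runs B Q s s' c) :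
    Runs B (.branch t P Q) s s' (c + 1) :=
  .of_step (fun _ _ => ⟨fun _ => by simp [step, ht], by simp⟩) hQ

lemma runs_loop_of_not (ht : ¬ t.Holds s) : Runs B (.loop t P) s s 1 :=
  runs_one (Nat.le_add_left 1 B) fun _ _ => ⟨fun _ => by simp [step, ht], by simp⟩

lemma Runs.loop (ht : t.Holds s) (hP : Runs B P s s' c) (hloop : Runs B (.loop t P) s' s'' d) :
    Runs B (.loop t P) s s'' (c + d + 1) :=
  .of_step_seq (fun _ _ => ⟨fun _ => by simp [step, ht], by simp⟩) hP hloop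

end Runs

/-- The effect of a straight-line program; the other commands are given the junk value `s`. -/
def Prog.effect : Prog → Store → Store
  | .push r a, s => s.push a r
  | .pop a, s => Function.update s a (s a).tail
  | .copy a b, s => s.push b (s.top a)
  | .arith o a b c, s => s.push c (o.eval (s.top a) (s.top b))
  | .seq P Q, s => Q.effect (P.effect s)
  | _, s => s

/-- The program is a straight line, and the numbers that it writes have length at most `B + 1`. -/
def Prog.Fits (B : ℕ) : Prog → Store → Prop
  | .nop, _ => True
  | .push r _, _ => len r ≤ B + 1
  | .pop _, _ => True
  | .copy a _, s => len (s.top a) ≤ B + 1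
  | .arith o a b _, s => len (o.eval (s.top a) (s.top b)) ≤ B + 1
  | .seq P Q, s => P.Fits B s ∧ Q.Fits B (P.effect s)
  | _, _ => False

/-- The number of steps of a straight-line program. -/
def Prog.steps : Prog → ℕ
  | .seq P Q => P.steps + Q.steps + 1
  | _ => 1

lemma Prog.Fits.runs {B : ℕ} : ∀ {P : Prog} {s : Store}, P.Fits B s →
    Runs B P s (P.effect s) P.steps
  | .nop, _, _ => runs_one (Nat.le_add_left 1 B) fun _ _ => ⟨fun _ => rfl, by simp⟩
  | .push _ _, _, h => runs_one h fun _ _ => ⟨fun _ => rfl, by simp⟩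
  | .pop _, _, _ => runs_one (Nat.le_add_left 1 B) fun _ _ => ⟨fun _ => rfl, by simp⟩
  | .copy _ _, _, h => runs_one h fun _ _ => ⟨fun _ => rfl, by simp⟩
  | .arith _ _ _ _, _, h => runs_one h fun _ _ => ⟨fun _ => rfl, by simp⟩
  | .seq _ _, _, h => Runs.seq h.1.runs h.2.runs

/-- Sequential composition of a list of programs. -/
def seqs (l : List Prog) : Prog := l.foldr .seq .nop

@[simp] lemma len_zero : len 0 = 1 := by simp [len]

@[simp] lemma len_one : len 1 = 1 := by simp [len]

@[simp] lemma len_neg_one : len (-1) = 1 := by simp [len]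

/-! ### The memory of the reduction -/

namespace Stack

abbrev input : ℕ := 0
abbrev output : ℕ := 1
abbrev query : ℕ := 2
abbrev tolerance : ℕ := 3
abbrev spread : ℕ := 4
abbrev tag : ℕ := 5
abbrev fresh : ℕ := 6
abbrev vars : ℕ := 7
abbrev givenVars : ℕ := 8
abbrev bufferA : ℕ := 9
abbrev bufferB : ℕ := 10
abbrev sources : ℕ := 11
abbrev targets : ℕ := 12
abbrev weight : ℕ := 13
abbrev scratch : ℕ := 14
abbrev zero : ℕ := 15
abbrev flag : ℕ := 16
abbrev falseVar : ℕ := 17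
abbrev half : ℕ := 18

end Stack

/-- The contents of the stacks that the reduction uses.

`query` holds the question as far as it is written, `tolerance` the error tolerance, `spread` the
product of the spreads of the given constraints, `tag` the number that distinguishes the next
unary constraints, `fresh` the next unused variable. The numbers of variables of the question and
of the given instance are kept in unary on `vars` and `givenVars`. The implications that are still
to be replaced are on `sources` and `targets`, and `weight` is the weight reached by the copies
written for the current one. `falseVar` is the variable forced to be false, and `half` is `1 / 2`.
`flag` controls the loops. The stack `Stack.zero` stays empty, so that it reads as zero. -/
structure Memory where
  (input output query tolerance spread tag fresh vars givenVars bufferA bufferB sources targets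
    weight scratch flag falseVar half : List ℝ)

namespace Memory

/-- The store whose stacks have the given contents. -/
def store (m : Memory) : Store
  | 0 => m.input
  | 1 => m.output
  | 2 => m.query
  | 3 => m.tolerance
  | 4 => m.spread
  | 5 => m.tag
  | 6 => m.fresh
  | 7 => m.vars
  | 8 => m.givenVars
  | 9 => m.bufferA
  | 10 => m.bufferB
  | 11 => m.sources
  | 12 => m.targets
  | 13 => m.weight
  | 14 => m.scratch
  | 16 => m.flag
  | 17 => m.falseVar
  | 18 => m.half
  | _ => []

lemma update_store_eq {m m' : Memory} {i : ℕ} {l : List ℝ} (hi : m'.store i = l)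
    (h : ∀ j < 19, j ≠ i → m'.store j = m.store j) :
    Function.update m.store i l = m'.store := by
  funext j
  rcases eq_or_ne j i with rfl | hj
  · rw [Function.update_self, hi]
  · rw [Function.update_of_ne hj]
    rcases lt_or_ge j 19 with hlt | hge
    · exact (h j hlt hj).symm
    · obtain ⟨r, rfl⟩ := Nat.exists_eq_add_of_le' hge
      rfl

@[simp] lemma update_store (m : Memory) (l : List ℝ) :
    Function.update m.store Stack.input l = { m with input := l : Memory }.store ∧
    Function.update m.store Stack.output l = { m with output := l : Memory }.store ∧
    Function.update m.store Stack.query l = { m with query := l : Memory }.store ∧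
    Function.update m.store Stack.tolerance l = { m with tolerance := l : Memory }.store ∧
    Function.update m.store Stack.spread l = { m with spread := l : Memory }.store ∧
    Function.update m.store Stack.tag l = { m with tag := l : Memory }.store ∧
    Function.update m.store Stack.fresh l = { m with fresh := l : Memory }.store ∧
    Function.update m.store Stack.vars l = { m with vars := l : Memory }.store ∧
    Function.update m.store Stack.givenVars l = { m with givenVars := l : Memory }.store ∧
    Function.update m.store Stack.bufferA l = { m with bufferA := l : Memory }.store ∧
    Function.update m.store Stack.bufferB l = { m with bufferB := l : Memory }.store ∧
    Function.update m.store Stack.sources l = { m with sources := l : Memory }.store ∧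
    Function.update m.store Stack.targets l = { m with targets := l : Memory }.store ∧
    Function.update m.store Stack.weight l = { m with weight := l : Memory }.store ∧
    Function.update m.store Stack.scratch l = { m with scratch := l : Memory }.store ∧
    Function.update m.store Stack.flag l = { m with flag := l : Memory }.store ∧
    Function.update m.store Stack.falseVar l = { m with falseVar := l : Memory }.store ∧
    Function.update m.store Stack.half l = { m with half := l : Memory }.store := by
  refine ⟨?_, ?_, ?_, ?_, ?_, ?_, ?_, ?_, ?_, ?_, ?_, ?_, ?_, ?_, ?_, ?_, ?_, ?_⟩ <;>
    refine update_store_eq rfl fun j hj hne => ?_ <;>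
    interval_cases j <;> first | rfl | exact absurd rfl hne

/-- The memory with all stacks empty. -/
def empty : Memory := ⟨[], [], [], [], [], [], [], [], [], [], [], [], [], [], [], [], [], []⟩

lemma store_empty : empty.store = fun _ => [] := by
  funext i
  simp only [store, empty]
  split <;> rfl

end Memory

/-- `Computes B P m m' c`: `Runs` for memories. -/
abbrev Computes (B : ℕ) (P : Prog) (m m' : Memory) (c : ℕ) : Prop := Runs B P m.store m'.store c

attribute [local simp] Prog.effect Prog.Fits Prog.steps seqs Store.push Store.top Op.eval
  Test.Holds Memory.store

section Computes

variable {B i c d : ℕ} {P : Prog} {m m' m'' : Memory}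

lemma Prog.Fits.computes (h : P.Fits B m.store) (heffect : P.effect m.store = m'.store)
    (hsteps : P.steps ≤ c) : Computes B P m m' c :=
  (heffect ▸ h.runs).mono hsteps

lemma computes_seqs_nil (m : Memory) : Computes B (seqs []) m m 1 :=
  Prog.Fits.computes trivial rfl le_rfl

lemma Runs.seqs_cons {s s' s'' : Store} {l : List Prog} (h : Runs B P s s' c)
    (hl : Runs B (seqs l) s' s'' d) : Runs B (seqs (P :: l)) s s'' (c + d + 1) :=
  h.seq hl

/-- Repeat `P` until stack `i` is empty. There is no test for non-emptiness, hence the flag. -/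
def untilEmpty (i : ℕ) (P : Prog) : Prog :=
  .seq (.loop (.empty Stack.flag) (.branch (.empty i) (.push 1 Stack.flag) P)) (.pop Stack.flag)

/-- `Iterates B i P m m' c`: repeating `P` until stack `i` is empty leads from `m` to `m'`, and the
total cost of the rounds is at most `c`. -/
inductive Iterates (B i : ℕ) (P : Prog) : Memory → Memory → ℕ → Prop
  | done {m : Memory} (c : ℕ) (hflag : m.flag = []) (hi : m.store i = []) : Iterates B i P m m c
  | step {m m' m'' : Memory} {c d e : ℕ} (hflag : m.flag = []) (hi : m.store i ≠ [])
      (hP : Computes B P m m' c) (h : Iterates B i P m' m'' d) (hcost : c + d + 2 ≤ e) :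
      Iterates B i P m m'' e

lemma Iterates.computes_loop (h : Iterates B i P m m' c) :
    Computes B (.loop (.empty Stack.flag) (.branch (.empty i) (.push 1 Stack.flag) P)) m
      { m' with flag := [1] } (c + 4) := by
  induction h with
  | @done m c hflag hi =>
    have hset : Computes B (.push 1 Stack.flag) m { m with flag := [1] } 1 :=
      Prog.Fits.computes (by simp) (by simp [hflag]) le_rfl
    have hround := hset.branch_pos (t := .empty i) (Q := P) hi
    exact (Runs.loop (show (Test.empty Stack.flag).Holds (Memory.store _) from hflag) hround
      (runs_loop_of_not (by simp))).mono (by omega)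
  | step hflag hi hP _ hcost ih =>
    have hround := hP.branch_neg (t := .empty i) (P := .push 1 Stack.flag) hi
    exact (Runs.loop (show (Test.empty Stack.flag).Holds (Memory.store _) from hflag) hround
      ih).mono (by omega)

lemma Iterates.flag_eq_nil (h : Iterates B i P m m' c) : m'.flag = [] := by
  induction h with
  | done _ hflag => exact hflag
  | step _ _ _ _ _ ih => exact ih

lemma Iterates.computes (h : Iterates B i P m m' c) :
    Computes B (untilEmpty i P) m m' (c + 6) := by
  have hclear : Computes B (.pop Stack.flag) { m' with flag := [1] } m' 1 :=
    Prog.Fits.computes trivial (by simp [← h.flag_eq_nil]) le_rfl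
  exact h.computes_loop.seq hclear

end Computes

/-! ### Parsing the input -/

/-- Multiply the top of `spread` by the growth of the top of `input`. -/
def absorb : Prog := seqs [.push 1 Stack.scratch,
  .arith .div Stack.scratch Stack.input Stack.weight,
  .arith .add Stack.scratch Stack.weight Stack.weight,
  .arith .add Stack.input Stack.weight Stack.weight,
  .arith .mul Stack.spread Stack.weight Stack.scratch, .pop Stack.spread,
  .copy Stack.scratch Stack.spread, .pop Stack.scratch, .pop Stack.scratch, .pop Stack.weight,
  .pop Stack.weight, .pop Stack.weight]

/-- Move ones from `input` to `vars` and `givenVars`, and add their number to `fresh`. -/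
def readUnary : Prog := .loop (.le Stack.zero Stack.input) (seqs [.push 1 Stack.givenVars,
  .push 1 Stack.vars, .arith .add Stack.fresh Stack.vars Stack.scratch, .pop Stack.fresh,
  .copy Stack.scratch Stack.fresh, .pop Stack.scratch, .pop Stack.input])

/-- Move nonnegative numbers from `input` to `bufferA`. -/
def readScope : Prog :=
  .loop (.le Stack.zero Stack.input) (seqs [.copy Stack.input Stack.bufferA, .pop Stack.input])

/-- Move nonnegative numbers from `input` to `bufferB`, and multiply `spread` by their growths. -/
def readTable : Prog :=
  .loop (.le Stack.zero Stack.input)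
    (seqs [absorb, .copy Stack.input Stack.bufferB, .pop Stack.input])

section

variable {B : ℕ} (m : Memory) {r z : ℝ} {l I : List ℝ}

lemma len_le_of_growth_le (hr : 0 ≤ r) (h : growth r ≤ 2 ^ B) :
    len r ≤ B + 1 ∧ len (1 / r) ≤ B + 1 ∧ len (1 + 1 / r) ≤ B + 1 := by
  have hinv : 0 ≤ 1 / r := by positivity
  rw [growth] at h
  have hlen : len r ≤ B + 1 := by
    rcases hr.eq_or_lt with rfl | hr
    · simp
    · have hinv_le : 1 / r ≤ 2 ^ B := by linarith
      rw [div_le_iff₀' hr] at hinv_le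
      exact len_le_of_bounds hr hinv_le (by linarith)
  refine ⟨hlen, ?_, len_le_of_one_le (by linarith) (by linarith)⟩
  rwa [one_div, len_inv]

lemma computes_absorb (hr : 0 ≤ r) (hz : 1 ≤ z) (h : z * growth r ≤ 2 ^ B) :
    Computes B absorb { m with input := r :: I, spread := [z] }
      { m with input := r :: I, spread := [z * growth r] } 25 := by
  have hgrowth := (le_mul_of_one_le_left (zero_le_one.trans (one_le_growth hr)) hz).trans h
  obtain ⟨-, hlen_inv, hlen_add⟩ := len_le_of_growth_le hr hgrowth
  have hlen_growth := len_le_of_one_le (one_le_growth hr) hgrowth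
  have hlen_mul := len_le_of_one_le (one_le_mul_of_one_le_of_one_le hz (one_le_growth hr)) h
  rw [growth] at hlen_growth hlen_mul
  rw [one_div] at hlen_inv hlen_add hlen_growth hlen_mul
  exact Prog.Fits.computes (by simp [absorb, hlen_inv, hlen_add, hlen_growth, hlen_mul])
    (by simp [absorb, growth]) (by simp [absorb])

lemma computes_readUnary {n v : ℕ} {V W : List ℝ}
    (hlen : ∀ u ≤ v + n, len (u : ℝ) ≤ B + 1) :
    Computes B readUnary
      { m with
        input := List.replicate n 1 ++ -1 :: I, fresh := [(v : ℝ)], vars := V, givenVars := W }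
      { m with
        input := -1 :: I, fresh := [((v + n : ℕ) : ℝ)], vars := List.replicate n 1 ++ V,
        givenVars := List.replicate n 1 ++ W }
      (16 * n + 1) := by
  induction n generalizing v V W with
  | zero => exact runs_loop_of_not (by simp)
  | succ n ih =>
    have hlen_succ := hlen (v + 1) (by omega)
    push_cast at hlen_succ
    have hrest := ih (v := v + 1) (V := 1 :: V) (W := 1 :: W) fun u hu => hlen u (by omega)
    have hround : Computes B (seqs [.push 1 Stack.givenVars, .push 1 Stack.vars,
          .arith .add Stack.fresh Stack.vars Stack.scratch, .pop Stack.fresh,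
          .copy Stack.scratch Stack.fresh, .pop Stack.scratch, .pop Stack.input])
        { m with
          input := List.replicate (n + 1) 1 ++ -1 :: I, fresh := [(v : ℝ)], vars := V,
          givenVars := W }
        { m with
          input := List.replicate n 1 ++ -1 :: I, fresh := [((v + 1 : ℕ) : ℝ)], vars := 1 :: V,
          givenVars := 1 :: W } 15 :=
      Prog.Fits.computes (by simp [List.replicate_succ, hlen_succ])
        (by simp [List.replicate_succ]) (by simp)
    have hreplicate (l : List ℝ) :
        List.replicate n 1 ++ 1 :: l = List.replicate (n + 1) 1 ++ l := by
      simp [List.replicate_succ']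
    rw [hreplicate, hreplicate, Nat.add_right_comm v 1 n] at hrest
    exact (Runs.loop (by simp [List.replicate_succ]) hround hrest).mono (by omega)

lemma computes_readScope {A : List ℝ} (h0 : ∀ r ∈ l, 0 ≤ r) (hlen : ∀ r ∈ l, len r ≤ B + 1) :
    Computes B readScope { m with input := l ++ -1 :: I, bufferA := A }
      { m with input := -1 :: I, bufferA := l.reverse ++ A } (6 * l.length + 1) := by
  induction l generalizing A with
  | nil => exact runs_loop_of_not (by simp)
  | cons r l ih =>
    rw [List.forall_mem_cons] at h0 hlen
    have hmove : Computes B (seqs [.copy Stack.input Stack.bufferA, .pop Stack.input])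
        { m with input := r :: (l ++ -1 :: I), bufferA := A }
        { m with input := l ++ -1 :: I, bufferA := r :: A } 5 :=
      Prog.Fits.computes (by simp [hlen.1]) (by simp) (by simp)
    rw [List.reverse_cons, List.append_assoc, List.length_cons]
    exact (Runs.loop (by simpa using h0.1) hmove (ih h0.2 hlen.2)).mono (by omega)

lemma one_le_prod_growth (h0 : ∀ r ∈ l, 0 ≤ r) : 1 ≤ (l.map growth).prod := by
  induction l with
  | nil => simp
  | cons r l ih =>
    rw [List.forall_mem_cons] at h0
    rw [List.map_cons, List.prod_cons]
    exact one_le_mul_of_one_le_of_one_le (one_le_growth h0.1) (ih h0.2)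

lemma computes_readTable {A : List ℝ} (h0 : ∀ r ∈ l, 0 ≤ r) (hz : 1 ≤ z)
    (h : z * (l.map growth).prod ≤ 2 ^ B) :
    Computes B readTable { m with input := l ++ -1 :: I, bufferB := A, spread := [z] }
      { m with
        input := -1 :: I, bufferB := l.reverse ++ A, spread := [z * (l.map growth).prod] }
      (34 * l.length + 1) := by
  induction l generalizing z A with
  | nil =>
    rw [List.map_nil, List.prod_nil, mul_one]
    exact runs_loop_of_not (by simp)
  | cons r l ih =>
    rw [List.map_cons, List.prod_cons, ← mul_assoc] at h ⊢
    rw [List.forall_mem_cons] at h0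
    have hz' := one_le_mul_of_one_le_of_one_le hz (one_le_growth h0.1)
    have hbound : z * growth r ≤ 2 ^ B :=
      (le_mul_of_one_le_right (zero_le_one.trans hz') (one_le_prod_growth h0.2)).trans h
    have hlen := (len_le_of_growth_le h0.1 <|
      (le_mul_of_one_le_left (zero_le_one.trans (one_le_growth h0.1)) hz).trans hbound).1
    have habsorb := computes_absorb { m with bufferB := A } (I := l ++ -1 :: I) h0.1 hz hbound
    have hmove : Computes B (seqs [.copy Stack.input Stack.bufferB, .pop Stack.input])
        { m with input := r :: (l ++ -1 :: I), bufferB := A, spread := [z * growth r] }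
        { m with input := l ++ -1 :: I, bufferB := r :: A, spread := [z * growth r] } 5 :=
      Prog.Fits.computes (by simp [hlen]) (by simp) (by simp)
    rw [List.reverse_cons, List.append_assoc, List.length_cons]
    exact (Runs.loop (by simpa using h0.1) (habsorb.seqs_cons hmove) (ih h0.2 hz' h)).mono
      (by omega)

end

/-- If the top of `bufferB` is `r`, remove it and continue with `P`; otherwise continue with
`Q`. -/
def matchTop (r : ℝ) (P Q : Prog) : Prog :=
  .seq (.push r Stack.scratch) (.branch (.le Stack.bufferB Stack.scratch)
    (.branch (.le Stack.scratch Stack.bufferB) (.seq (.pop Stack.scratch)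
      (.seq (.pop Stack.bufferB) P)) (.seq (.pop Stack.scratch) Q))
    (.seq (.pop Stack.scratch) Q))

/-- If the content of `bufferB` is `l`, erase it and continue with `P`; otherwise restore it and
continue with `Q`. -/
def matchStack : List ℝ → Prog → Prog → Prog
  | [], P, Q => .branch (.empty Stack.bufferB) P Q
  | r :: l, P, Q => .branch (.empty Stack.bufferB) Q
      (matchTop r (matchStack l P (.seq (.push r Stack.bufferB) Q)) Q)

section

variable {B : ℕ} (m : Memory) {m' : Memory} {P Q : Prog} {c : ℕ} {r r' : ℝ} {b l : List ℝ}

lemma computes_matchTop_eq (hr : len r ≤ B + 1) (Q : Prog)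
    (hP : Computes B P { m with bufferB := b } m' c) :
    Computes B (matchTop r P Q) { m with bufferB := r :: b } m' (c + 8) := by
  have hpush : Computes B (.push r Stack.scratch) { m with bufferB := r :: b }
      { m with bufferB := r :: b, scratch := r :: m.scratch } 1 :=
    Prog.Fits.computes (by simpa) (by simp) le_rfl
  have hpop : Computes B (.pop Stack.scratch)
      { m with bufferB := r :: b, scratch := r :: m.scratch } { m with bufferB := r :: b } 1 :=
    Prog.Fits.computes trivial (by simp) le_rfl
  have hpopB :
      Computes B (.pop Stack.bufferB) { m with bufferB := r :: b } { m with bufferB := b } 1 :=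
    Prog.Fits.computes trivial (by simp) le_rfl
  exact (hpush.seq (.branch_pos (by simp) (.branch_pos (by simp) (hpop.seq (hpopB.seq hP))))).mono
    (by omega)

lemma computes_matchTop_ne (hr : len r ≤ B + 1) (hne : r' ≠ r) (P : Prog)
    (hQ : Computes B Q { m with bufferB := r' :: b } m' c) :
    Computes B (matchTop r P Q) { m with bufferB := r' :: b } m' (c + 6) := by
  have hpush : Computes B (.push r Stack.scratch) { m with bufferB := r' :: b }
      { m with bufferB := r' :: b, scratch := r :: m.scratch } 1 :=
    Prog.Fits.computes (by simpa) (by simp) le_rfl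
  have hpop : Computes B (.pop Stack.scratch)
      { m with bufferB := r' :: b, scratch := r :: m.scratch } { m with bufferB := r' :: b } 1 :=
    Prog.Fits.computes trivial (by simp) le_rfl
  have hpopQ := hpop.seq hQ
  rcases hne.lt_or_gt with hlt | hgt
  · exact (hpush.seq (.branch_pos (by simpa using hlt.le)
      (.branch_neg (by simpa using hlt) hpopQ))).mono (by omega)
  · exact (hpush.seq (.branch_neg (by simpa using hgt) hpopQ)).mono (by omega)

lemma computes_matchStack_eq (hl : ∀ r ∈ l, len r ≤ B + 1) (Q : Prog)
    (hP : Computes B P { m with bufferB := [] } m' c) :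
    Computes B (matchStack l P Q) { m with bufferB := l } m' (c + 9 * l.length + 1) := by
  induction l generalizing Q with
  | nil => exact hP.branch_pos rfl
  | cons r l ih =>
    rw [List.forall_mem_cons] at hl
    exact ((computes_matchTop_eq m hl.1 Q (ih hl.2 _)).branch_neg (by simp)).mono
      (by rw [List.length_cons]; omega)

lemma computes_matchStack_ne (hl : ∀ r ∈ l, len r ≤ B + 1) (hb : b ≠ l) (P : Prog)
    (hQ : Computes B Q { m with bufferB := b } m' c) :
    Computes B (matchStack l P Q) { m with bufferB := b } m' (c + 11 * l.length + 1) := by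
  induction l generalizing b Q c with
  | nil => exact hQ.branch_neg hb
  | cons r l ih =>
    rw [List.forall_mem_cons] at hl
    rw [List.length_cons]
    obtain - | ⟨r', b⟩ := b
    · exact (hQ.branch_pos (by simp)).mono (by omega)
    · refine (Runs.branch_neg (c := c + 11 * l.length + 11) (by simp) ?_).mono (by omega)
      by_cases hr : r' = r
      · subst hr
        have hpush : Computes B (.push r' Stack.bufferB) { m with bufferB := b }
            { m with bufferB := r' :: b } 1 :=
          Prog.Fits.computes (by simpa using hl.1) (by simp) le_rfl
        exact (computes_matchTop_eq m hl.1 Q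
          (ih hl.2 (fun h => hb (h ▸ rfl)) (hpush.seq hQ))).mono (by omega)
      · exact (computes_matchTop_ne m hl.1 hr _ hQ).mono (by omega)

end

/-- Move the content of stack `i` to stack `j`, in reversed order. -/
def moveStack (i j : ℕ) : Prog := untilEmpty i (seqs [.copy i j, .pop i])

lemma computes_moveStack {B i j : ℕ} (hij : i ≠ j) (hi : i ≠ Stack.flag) (hj : j ≠ Stack.flag)
    {s : Store} (hs : s Stack.flag = []) (M : List ℝ → List ℝ → Memory)
    (hM : ∀ a b, (M a b).store = Function.update (Function.update s i a) j b) {l : List ℝ}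
    (hl : ∀ r ∈ l, len r ≤ B + 1) (l' : List ℝ) :
    Computes B (moveStack i j) (M l l') (M [] (l.reverse ++ l')) (7 * l.length + 6) := by
  have hflag (a b : List ℝ) : (M a b).flag = [] := by
    change (M a b).store Stack.flag = []
    rw [hM, Function.update_of_ne hj.symm, Function.update_of_ne hi.symm, hs]
  refine Iterates.computes ?_
  induction l generalizing l' with
  | nil => exact .done _ (hflag _ _) (by simp [hM, hij, -Memory.store])
  | cons r l ih =>
    rw [List.forall_mem_cons] at hl
    have hmove : Computes B (seqs [.copy i j, .pop i]) (M (r :: l) l') (M l (r :: l')) 5 := by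
      refine Prog.Fits.computes (by simp [hM, hij, hl.1, -Memory.store]) ?_ (by simp)
      rw [hM, hM]
      simp [hij, Function.update_comm hij.symm]
    rw [List.reverse_cons, List.append_assoc, List.length_cons]
    exact .step (hflag _ _) (by simp [hM, hij, -Memory.store]) hmove (ih hl.2 _) (by omega)

/-- The first entries of a list of pairs, as real numbers. -/
def firsts (l : List (ℕ × ℕ)) : List ℝ := l.map fun p => (p.1 : ℝ)

/-- The second entries of a list of pairs, as real numbers. -/
def seconds (l : List (ℕ × ℕ)) : List ℝ := l.map fun p => (p.2 : ℝ)

/-- The indices of the variables of an application, as real numbers. -/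
def Application.indices (c : Application) : List ℝ := List.ofFn fun j => (c.scope j : ℝ)

/-- The memory after the applications `L` have been read: implications are stored in pairs, all
others are copied to `query`. -/
def Memory.parsed (m : Memory) (L : List Application) : Memory :=
  { m with
    query := (others L).flatMap Application.code ++ m.query
    sources := firsts (impPairs L) ++ m.sources
    targets := seconds (impPairs L) ++ m.targets }

/-- Move the two indices on `bufferA` to `sources` and `targets`. -/
def storePair : Prog :=
  seqs [.copy Stack.bufferA Stack.targets, .pop Stack.bufferA, .copy Stack.bufferA Stack.sources,
    .pop Stack.bufferA]

/-- Write the application on `bufferA` and `bufferB` to `query`. -/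
def writeBack : Prog :=
  seqs [.push (-1) Stack.query, moveStack Stack.bufferB Stack.query, .push (-1) Stack.query,
    moveStack Stack.bufferA Stack.query]

/-- Deal with the application on `bufferA` and `bufferB` according to whether its constraint is
`Implies`. -/
def sortApplication : Prog := matchStack impTable.reverse storePair writeBack

/-- Read an application. -/
def readApplication : Prog :=
  seqs [readScope, .pop Stack.input, readTable, .pop Stack.input, sortApplication]

/-- Read all applications. -/
def parse : Prog := untilEmpty Stack.input readApplication

lemma Constraint.coe_spread (f : Constraint) : (f.spread : ℝ) = (f.table.map growth).prod := by
  rw [spread, NNReal.coe_list_prod, table, List.map_map, List.map_map]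
  congr 1
  refine List.map_congr_left fun x _ => ?_
  simp only [Function.comp_apply, growth, NNReal.coe_add, NNReal.coe_one, NNReal.coe_inv, one_div]
  ring

lemma Constraint.nonneg_of_mem_table {f : Constraint} {r : ℝ} (hr : r ∈ f.table) : 0 ≤ r := by
  obtain ⟨x, -, rfl⟩ := List.mem_map.1 hr
  exact (f.val x).2

lemma Constraint.len_le_of_mem_table {f : Constraint} {B : ℕ} (h : (f.spread : ℝ) ≤ 2 ^ B) :
    ∀ r ∈ f.table, len r ≤ B + 1 := by
  intro r hr
  refine (len_le_of_growth_le (nonneg_of_mem_table hr) (le_trans ?_ h)).1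
  obtain ⟨x, -, rfl⟩ := List.mem_map.1 hr
  calc growth (f.val x) = (1 + f.val x + (f.val x)⁻¹ : ℝ≥0) := by
        rw [growth]
        push_cast
        ring
    _ ≤ f.spread := NNReal.coe_le_coe.2 (f.le_spread x)

namespace Application

variable {c : Application}

lemma indices_of_table_eq (h : c.con.table = impTable) :
    c.indices = [(c.pair.1 : ℝ), (c.pair.2 : ℝ)] := by
  obtain ⟨f, u⟩ := c
  obtain rfl := eq_implies_of_table_eq h
  rfl

lemma length_code (c : Application) :
    c.code.length = c.indices.length + c.con.table.length + 2 := by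
  simp only [code, indices, List.length_append, List.length_cons, List.length_nil]
  omega

lemma code_append (c : Application) (l : List ℝ) :
    c.code ++ l = c.indices ++ -1 :: (c.con.table ++ -1 :: l) := by
  simp [code, indices]

end Application

lemma Memory.parsed_nil (m : Memory) : m.parsed [] = m := by
  simp [parsed, others, impPairs, firsts, seconds]

lemma Memory.parsed_singleton_of_eq (m : Memory) {c : Application} (h : c.con.table = impTable) :
    m.parsed [c] =
      { m with
        sources := (c.pair.1 : ℝ) :: m.sources
        targets := (c.pair.2 : ℝ) :: m.targets } := by
  simp [parsed, others, impPairs, firsts, seconds, h]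

lemma Memory.parsed_singleton_of_ne (m : Memory) {c : Application} (h : c.con.table ≠ impTable) :
    m.parsed [c] = { m with query := c.code ++ m.query } := by
  simp [parsed, others, impPairs, firsts, seconds, h]

lemma Memory.parsed_cons (m : Memory) (c : Application) (L : List Application) :
    m.parsed (c :: L) = (m.parsed [c]).parsed L := by
  by_cases h : c.con.table = impTable <;>
    simp [parsed, others, impPairs, firsts, seconds, h]

section

variable {B : ℕ} (m : Memory) {c : Application} {I A : List ℝ} {z : ℝ}

lemma computes_storePair {x y : ℝ} (hx : len x ≤ B + 1) (hy : len y ≤ B + 1) :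
    Computes B storePair { m with bufferA := [y, x] }
      { m with bufferA := [], sources := x :: m.sources, targets := y :: m.targets } 9 :=
  Prog.Fits.computes (by simp [storePair, hx, hy]) (by simp [storePair]) (by simp [storePair])

lemma computes_writeBack (hm : m.flag = []) {a b : List ℝ} (ha : ∀ r ∈ a, len r ≤ B + 1)
    (hb : ∀ r ∈ b, len r ≤ B + 1) :
    Computes B writeBack { m with bufferA := a, bufferB := b }
      { m with
        bufferA := [], bufferB := [], query := a.reverse ++ -1 :: (b.reverse ++ -1 :: m.query) }
      (7 * a.length + 7 * b.length + 19) := by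
  have hmark (m : Memory) :
      Computes B (.push (-1) Stack.query) m { m with query := -1 :: m.query } 1 :=
    Prog.Fits.computes (by simp) (by simp) le_rfl
  have htable := computes_moveStack (i := Stack.bufferB) (j := Stack.query) (by decide) (by decide)
    (by decide) (s := { m with bufferA := a : Memory }.store) hm
    (fun b q => { m with bufferA := a, bufferB := b, query := q }) (by simp [-Memory.store]) hb
    (-1 :: m.query)
  have hscope := computes_moveStack (i := Stack.bufferA) (j := Stack.query) (by decide) (by decide)
    (by decide) (s := { m with bufferB := [] : Memory }.store) hm
    (fun a q => { m with bufferA := a, bufferB := [], query := q }) (by simp [-Memory.store]) ha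
    (-1 :: (b.reverse ++ -1 :: m.query))
  exact ((hmark _).seqs_cons (htable.seqs_cons ((hmark _).seqs_cons (hscope.seqs_cons
    (computes_seqs_nil _))))).mono (by omega)

lemma len_le_of_mem_impTable : ∀ r ∈ impTable.reverse, len r ≤ B + 1 := by
  simp [impTable]

lemma computes_sortApplication (hm : m.flag = []) (hscope : ∀ r ∈ c.indices, len r ≤ B + 1)
    (htable : ∀ r ∈ c.con.table, len r ≤ B + 1) :
    Computes B sortApplication
      { m with bufferA := c.indices.reverse, bufferB := c.con.table.reverse }
      { m.parsed [c] with bufferA := [], bufferB := [] }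
      (7 * c.indices.length + 7 * c.con.table.length + 64) := by
  by_cases h : c.con.table = impTable
  · rw [m.parsed_singleton_of_eq h, h]
    rw [c.indices_of_table_eq h] at hscope ⊢
    rw [List.forall_mem_cons, List.forall_mem_singleton] at hscope
    have hstore := computes_storePair { m with bufferB := [] } hscope.1 hscope.2
    exact (computes_matchStack_eq { m with bufferA := [(c.pair.2 : ℝ), (c.pair.1 : ℝ)] }
      len_le_of_mem_impTable writeBack hstore).mono (by simp [impTable])
  · have hwrite := computes_writeBack m hm (a := c.indices.reverse) (b := c.con.table.reverse)
      (by simpa using hscope) (by simpa using htable)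
    rw [List.reverse_reverse, List.reverse_reverse, ← c.code_append] at hwrite
    rw [m.parsed_singleton_of_ne h]
    exact (computes_matchStack_ne { m with bufferA := c.indices.reverse } len_le_of_mem_impTable
      (fun he => h (List.reverse_injective he)) storePair hwrite).mono (by simp [impTable])

lemma computes_readApplication (hm : m.flag = []) (hz : 1 ≤ z) (h : z * c.con.spread ≤ 2 ^ B)
    (hscope : ∀ j, len (c.scope j : ℝ) ≤ B + 1) :
    Computes B readApplication
      { m with input := c.code ++ I, spread := [z], bufferA := [], bufferB := [] }
      { m.parsed [c] with
        input := I, spread := [z * c.con.spread], bufferA := [], bufferB := [] }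
      (60 * c.code.length) := by
  have hscope' : ∀ r ∈ c.indices, len r ≤ B + 1 := by
    simpa [Application.indices, List.forall_mem_ofFn_iff] using hscope
  have hnonneg : ∀ r ∈ c.indices, 0 ≤ r := by
    simp [Application.indices]
  have htable := Constraint.len_le_of_mem_table <|
    (le_mul_of_one_le_left c.con.spread.2 hz).trans h
  have hpop (m : Memory) (r : ℝ) (l : List ℝ) :
      Computes B (.pop Stack.input) { m with input := r :: l } { m with input := l } 1 :=
    Prog.Fits.computes trivial (by simp) le_rfl
  have hreadScope := computes_readScope { m with spread := [z], bufferB := [] }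
    (I := c.con.table ++ -1 :: I) (A := []) hnonneg hscope'
  have hreadTable := computes_readTable { m with bufferA := c.indices.reverse } (I := I) (A := [])
    (fun r => Constraint.nonneg_of_mem_table) hz (by rwa [← Constraint.coe_spread])
  rw [← Constraint.coe_spread] at hreadTable
  simp only [List.append_nil] at hreadScope hreadTable
  have hsort := computes_sortApplication { m with input := I, spread := [z * c.con.spread] }
    hm hscope' htable
  have htable_pos : 1 ≤ c.con.table.length := by
    rw [Constraint.table, List.length_map, length_points]
    exact Nat.one_le_two_pow
  rw [c.code_append, c.length_code]
  have hrest := hreadTable.seqs_cons <| (hpop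
    { m with
      bufferA := c.indices.reverse, bufferB := c.con.table.reverse, spread := [z * c.con.spread] }
    (-1) I).seqs_cons <| hsort.seqs_cons (computes_seqs_nil _)
  exact (hreadScope.seqs_cons <| (hpop
    { m with bufferA := c.indices.reverse, spread := [z], bufferB := [] } (-1)
    (c.con.table ++ -1 :: I)).seqs_cons hrest).mono (by linarith [htable_pos])

lemma computes_parse {L : List Application} (hm : m.flag = []) (hz : 1 ≤ z)
    (h : z * totalSpread L ≤ 2 ^ B) (hscope : ∀ c ∈ L, ∀ j, len (c.scope j : ℝ) ≤ B + 1) :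
    Computes B parse
      { m with
        input := L.flatMap Application.code, spread := [z], bufferA := [], bufferB := [] }
      { m.parsed L with input := [], spread := [z * totalSpread L], bufferA := [], bufferB := [] }
      (62 * (L.flatMap Application.code).length + 6) := by
  refine Iterates.computes ?_
  induction L generalizing m z with
  | nil =>
    rw [m.parsed_nil]
    simpa [totalSpread] using .done _ hm (by simp)
  | cons c L ih =>
    rw [List.forall_mem_cons] at hscope
    have hspread : (1 : ℝ) ≤ c.con.spread := NNReal.coe_le_coe.2 c.con.one_le_spread
    have hspread' : (1 : ℝ) ≤ totalSpread L := NNReal.coe_le_coe.2 (one_le_totalSpread L)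
    rw [totalSpread_cons, NNReal.coe_mul, ← mul_assoc] at h ⊢
    have hz' := one_le_mul_of_one_le_of_one_le hz hspread
    have hread := computes_readApplication m (I := L.flatMap Application.code) hm hz
      ((le_mul_of_one_le_right (zero_le_one.trans hz') hspread').trans h) hscope.1
    rw [m.parsed_cons, List.flatMap_cons, List.length_append]
    have hlen := c.length_code
    exact .step hm (by simp [c.code_append]) hread (ih (m.parsed [c]) hm hz' h hscope.2) (by omega)

end

/-! ### Writing the links -/

/-- A number to be written: a constant, or the top of a stack. -/
inductive Item
  | const (r : ℝ)
  | top (i : ℕ)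

namespace Item

/-- The number that an item stands for. -/
def eval (s : Store) : Item → ℝ
  | const r => r
  | top i => s.top i

/-- Push an item on `query`. -/
def write : Item → Prog
  | const r => .push r Stack.query
  | top i => .copy i Stack.query

end Item

/-- Push items on `query`, last item first. -/
def writeItems (l : List Item) : Prog := seqs (l.reverse.map Item.write)

/-- The code of a unary constraint, given its variable and its values. -/
def unaryItems (x u v : Item) : List Item := [x, .const (-1), u, v, .const (-1)]

/-- Write the unary constraint `(tag, tag * r)` on the variable on top of stack `i`, and increase
`tag`. -/
def writeScaled (r : ℝ) (i : ℕ) : Prog :=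
  seqs [.push r Stack.scratch, .arith .mul Stack.tag Stack.scratch Stack.scratch,
    writeItems (unaryItems (.top i) (.top Stack.tag) (.top Stack.scratch)), .pop Stack.scratch,
    .pop Stack.scratch, .push 1 Stack.scratch,
    .arith .add Stack.tag Stack.scratch Stack.scratch, .pop Stack.tag,
    .copy Stack.scratch Stack.tag, .pop Stack.scratch, .pop Stack.scratch]

/-- Increase the number of variables. -/
def newVar : Prog :=
  seqs [.push 1 Stack.vars, .push 1 Stack.scratch,
    .arith .add Stack.fresh Stack.scratch Stack.scratch, .pop Stack.fresh,
    .copy Stack.scratch Stack.fresh, .pop Stack.scratch, .pop Stack.scratch]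

/-- Multiply the top of `weight` by `r`. -/
def decay (r : ℝ) : Prog :=
  seqs [.push r Stack.scratch, .arith .mul Stack.weight Stack.scratch Stack.scratch,
    .pop Stack.weight, .copy Stack.scratch Stack.weight, .pop Stack.scratch, .pop Stack.scratch]

/-- The memory that holds the partial instance `s`, with `weight` containing `w`. -/
def Memory.building (m : Memory) (s : PartialInstance) (w : List ℝ) : Memory :=
  { m with
    query := s.applications.flatMap Application.code
    fresh := [(s.fresh : ℝ)]
    vars := List.replicate s.fresh 1
    tag := [(s.tag : ℝ)]
    weight := w }

/-- The memory that holds the pairs `l`, whose implications are still to be replaced. -/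
def Memory.queue (m : Memory) (l : List (ℕ × ℕ)) : Memory :=
  { m with
    sources := firsts l
    targets := seconds l }

lemma code_unaryApp (u v : ℝ≥0) (x : ℕ) :
    (unaryApp u v x).code = [(x : ℝ), -1, (u : ℝ), (v : ℝ), -1] := by
  simp [Application.code, unaryApp, Constraint.table, points]

section

variable {B : ℕ} {m : Memory} {s : PartialInstance} {w : List ℝ}

lemma Item.eval_update_query {l : List ℝ} {a : Item} (ha : a ≠ .top Stack.query) :
    a.eval { m with query := l : Memory }.store = a.eval m.store := by
  cases a with
  | const r => rfl
  | top i =>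
    have hi : i ≠ Stack.query := fun h => ha (h ▸ rfl)
    have hstore : { m with query := l : Memory }.store i = m.store i := by
      rw [← (Memory.update_store m l).2.2.1, Function.update_of_ne hi]
    simp only [eval, Store.top, hstore]

lemma computes_write {a : Item} (ha : len (a.eval m.store) ≤ B + 1) :
    Computes B a.write m { m with query := a.eval m.store :: m.query } 1 := by
  cases a with
  | const r => exact Prog.Fits.computes ha (by simp [Item.write, Item.eval]) le_rfl
  | top i =>
    exact Prog.Fits.computes ha (Memory.update_store m _).2.2.1 le_rfl

lemma computes_writeItems {l : List Item} (hq : ∀ a ∈ l, a ≠ .top Stack.query)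
    (hlen : ∀ a ∈ l, len (a.eval m.store) ≤ B + 1) :
    Computes B (writeItems l) m { m with query := l.map (Item.eval m.store) ++ m.query }
      (2 * l.length + 1) := by
  rw [writeItems]
  induction l using List.reverseRecOn generalizing m with
  | nil => exact computes_seqs_nil m
  | append_singleton l a ih =>
    simp only [List.forall_mem_append, List.forall_mem_singleton] at hq hlen
    have heval : ∀ b ∈ l, b.eval { m with query := a.eval m.store :: m.query : Memory }.store =
        b.eval m.store := fun b hb => Item.eval_update_query (hq.1 b hb)
    have hrest := ih (m := { m with query := a.eval m.store :: m.query }) hq.1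
      fun b hb => (heval b hb).symm ▸ hlen.1 b hb
    rw [List.map_congr_left heval] at hrest
    simp only [List.reverse_append, List.reverse_singleton, List.singleton_append, List.map_append,
      List.map_cons, List.map_nil, List.append_assoc, List.length_append, List.length_singleton]
    exact ((computes_write hlen.2).seqs_cons hrest).mono (by omega)

lemma computes_writeCode {l : List Item} {c : Application} (hq : ∀ a ∈ l, a ≠ .top Stack.query)
    (hl : l.map (Item.eval (m.building s w).store) = c.code)
    (hlen : ∀ r ∈ c.code, len r ≤ B + 1) :
    Computes B (writeItems l) (m.building s w)
      (m.building { s with applications := c :: s.applications } w) (2 * l.length + 1) := by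
  have h := computes_writeItems (m := m.building s w) hq fun a ha =>
    hlen _ (hl ▸ List.mem_map_of_mem ha)
  rwa [hl] at h

lemma computes_writeScaled {r : ℝ≥0} {i x : ℕ} (hi : i = Stack.sources ∨ i = Stack.targets)
    (hx : m.store.top i = x) (hlen : len (x : ℝ) ≤ B + 1) (hr : len (r : ℝ) ≤ B + 1)
    (htag : len (s.tag : ℝ) ≤ B + 1) (htag_mul : len (s.tag * r : ℝ) ≤ B + 1)
    (htag_add : len (s.tag + 1 : ℝ) ≤ B + 1) :
    Computes B (writeScaled r i) (m.building s w)
      (m.building ⟨unaryApp s.tag (s.tag * r) x :: s.applications, s.fresh, s.tag + 1⟩ w) 44 := by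
  rcases hi with rfl | rfl
  all_goals
    simp only [Store.top, Memory.store, List.headD_eq_head?_getD] at hx
    exact Prog.Fits.computes
      (by simp [writeScaled, writeItems, unaryItems, Item.write, Memory.building, *])
      (by simp [writeScaled, writeItems, unaryItems, Item.write, Memory.building, code_unaryApp,
        hx])
      (by simp [writeScaled, writeItems, unaryItems, Item.write])

lemma computes_newVar (hlen : len (s.fresh + 1 : ℝ) ≤ B + 1) :
    Computes B newVar (m.building s w) (m.building { s with fresh := s.fresh + 1 } w) 15 :=
  Prog.Fits.computes (by simp [newVar, Memory.building, hlen])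
    (by simp [newVar, Memory.building, List.replicate_succ]) (by simp [newVar])

lemma computes_decay {v r : ℝ} (hr : len r ≤ B + 1) (hmul : len (v * r) ≤ B + 1) :
    Computes B (decay r) (m.building s [v]) (m.building s [v * r]) 13 :=
  Prog.Fits.computes (by simp [decay, Memory.building, hr, hmul])
    (by simp [decay, Memory.building]) (by simp [decay])

end

namespace SupermodularPin

variable (G : SupermodularPin)

/-- The code of `G.apply`, given the stacks with the variables on top. -/
def applyItems (i j : ℕ) : List Item :=
  List.ofFn (fun p => .top (pin G.fst G.snd i j Stack.falseVar p)) ++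
    .const (-1) :: (G.con.table.map .const ++ [.const (-1)])

/-- Write one link between the variables on top of `sources` and `targets`. -/
def writeCopy : Prog :=
  seqs [writeScaled G.sourceScale Stack.sources, writeScaled G.targetScale Stack.targets,
    writeItems (unaryItems (.top Stack.fresh) (.const 1) (.const (G.sourceScale * G.targetScale))),
    writeItems (G.applyItems Stack.sources Stack.fresh),
    writeItems (G.applyItems Stack.fresh Stack.targets), newVar, decay G.ratio]

/-- The number of steps of `writeCopy`. -/
def copyCost : ℕ := 4 * (G.con.arity + 2 ^ G.con.arity + 2) + 200

/-- Write links until the number on `weight` is below `1 / 2`. -/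
def writeCopies : Prog := .loop (.le Stack.half Stack.weight) G.writeCopy

/-- Replace the implications stored in `sources` and `targets`. -/
def replaceAll : Prog :=
  untilEmpty Stack.sources (seqs [.arith .mul Stack.spread Stack.spread Stack.weight,
    G.writeCopies, .pop Stack.weight, .pop Stack.sources, .pop Stack.targets])

/-- All numbers that occur in a construction with tags up to `tmax`, variables up to `vmax` and
weights up to `wmax` have length at most `B + 1`. -/
structure NumberBounds (B : ℕ) (tmax : ℝ≥0) (vmax : ℕ) (wmax : ℝ) : Prop where
  half : len (1 / 2) ≤ B + 1
  table : ∀ r ∈ G.con.table, len r ≤ B + 1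
  sourceScale : len (G.sourceScale : ℝ) ≤ B + 1
  targetScale : len (G.targetScale : ℝ) ≤ B + 1
  scale_mul : len (G.sourceScale * G.targetScale : ℝ) ≤ B + 1
  ratio : len (G.ratio : ℝ) ≤ B + 1
  base : len (G.base : ℝ) ≤ B + 1
  tag : ∀ t : ℝ≥0, 1 ≤ t → t ≤ tmax → len (t : ℝ) ≤ B + 1 ∧
    len (t * G.sourceScale : ℝ) ≤ B + 1 ∧ len (t * G.targetScale : ℝ) ≤ B + 1
  var : ∀ v ≤ vmax, len (v : ℝ) ≤ B + 1
  weight : ∀ w : ℝ, G.ratio / 2 ≤ w → w ≤ wmax → len w ≤ B + 1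

variable {G} {B : ℕ} {m : Memory} {s : PartialInstance}

lemma computes_writeApply {w : List ℝ} {i j x y o : ℕ} (hi : i ≠ Stack.query)
    (hj : j ≠ Stack.query) (hx : (m.building s w).store.top i = x)
    (hy : (m.building s w).store.top j = y) (ho : m.falseVar = [(o : ℝ)])
    (hlx : len (x : ℝ) ≤ B + 1) (hly : len (y : ℝ) ≤ B + 1) (hlo : len (o : ℝ) ≤ B + 1)
    (htable : ∀ r ∈ G.con.table, len r ≤ B + 1) :
    Computes B (writeItems (G.applyItems i j)) (m.building s w)
      (m.building { s with applications := G.apply x y o :: s.applications } w)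
      (2 * (G.con.arity + 2 ^ G.con.arity + 2) + 1) := by
  have hpin (p) : (m.building s w).store.top (pin G.fst G.snd i j Stack.falseVar p) =
      (pin G.fst G.snd x y o p : ℕ) := by
    simp only [pin]
    split_ifs
    · exact hx
    · exact hy
    · simp [Memory.building, ho]
  have hcode :
      (G.applyItems i j).map (Item.eval (m.building s w).store) = (G.apply x y o).code := by
    simp [applyItems, Application.code, apply, List.map_ofFn, Function.comp_def, Item.eval, hpin,
      -Memory.store, -Store.top]
  have hlength : (G.applyItems i j).length = G.con.arity + 2 ^ G.con.arity + 2 := by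
    simp only [applyItems, Constraint.table, List.length_append, List.length_ofFn, List.length_cons,
      List.length_map, length_points, List.length_nil]
    omega
  rw [← hlength]
  refine computes_writeCode ?_ hcode ?_
  · simp only [applyItems, List.mem_append, List.mem_ofFn, List.mem_cons, List.mem_map]
    rintro a (⟨p, rfl⟩ | rfl | ⟨r, -, rfl⟩ | rfl | ha)
    · simp only [pin, ne_eq, Item.top.injEq]
      split_ifs
      exacts [hi, hj, by decide]
    all_goals simp_all
  · simp only [Application.code, apply, List.mem_append, List.mem_ofFn, List.mem_cons]
    rintro a (⟨p, rfl⟩ | rfl | ha | rfl | ha)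
    · simp only [pin]
      split_ifs
      exacts [hlx, hly, hlo]
    · simp
    · exact htable a ha
    · simp
    · simp at ha

end SupermodularPin

namespace SupermodularPin

variable {G : SupermodularPin} {B : ℕ} {m : Memory} {s : PartialInstance}

namespace NumberBounds

variable {tmax : ℝ≥0} {vmax : ℕ} {wmax : ℝ}

lemma weight_mul_ratio (h : G.NumberBounds B tmax vmax wmax) {w : ℝ} (hw : 1 / 2 ≤ w)
    (hw2 : w ≤ wmax) : w * G.ratio ≤ w ∧ len (w * G.ratio) ≤ B + 1 := by
  have hratio : (G.ratio : ℝ) ≤ 1 := by exact_mod_cast G.ratio_lt_one.le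
  have hle : w * G.ratio ≤ w := mul_le_of_le_one_right (by linarith) hratio
  refine ⟨hle, h.weight _ ?_ (hle.trans hw2)⟩
  nlinarith [G.ratio.coe_nonneg]

lemma computes_writeCopy (h : G.NumberBounds B tmax vmax wmax) {w : ℝ} {x y o : ℕ}
    {X Y : List ℝ} (hx : m.sources = (x : ℝ) :: X) (hy : m.targets = (y : ℝ) :: Y)
    (ho : m.falseVar = [(o : ℝ)]) (hxv : x ≤ vmax) (hyv : y ≤ vmax) (hov : o ≤ vmax)
    (htag : 1 ≤ s.tag) (htag2 : s.tag + 2 ≤ tmax) (hfresh : s.fresh + 1 ≤ vmax)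
    (hw : 1 / 2 ≤ w) (hw2 : w ≤ wmax) :
    Computes B G.writeCopy (m.building s [w]) (m.building (G.addCopy o x y s) [w * G.ratio])
      G.copyCost := by
  have htag1 : s.tag + 1 ≤ tmax := le_trans (by gcongr; exact one_le_two) htag2
  have hsucc : s.tag + 1 + 1 = s.tag + 2 := by rw [add_assoc, one_add_one_eq_two]
  obtain ⟨ht, hts, -⟩ := h.tag s.tag htag (le_self_add.trans htag1)
  obtain ⟨ht', -, htt⟩ := h.tag (s.tag + 1) (htag.trans le_self_add) htag1
  obtain ⟨ht'', -⟩ := h.tag (s.tag + 1 + 1) (htag.trans (by simp [hsucc])) (hsucc ▸ htag2)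
  have hv := h.var s.fresh (by omega)
  have hv' := h.var (s.fresh + 1) hfresh
  push_cast at ht' ht'' htt hv'
  have hcode : ∀ r ∈ (unaryApp 1 (G.sourceScale * G.targetScale) s.fresh).code,
      len r ≤ B + 1 := by
    simp [code_unaryApp, hv, h.scale_mul]
  have hcopy : G.addCopy o x y s =
      ⟨G.link x y o s.fresh s.tag ++ s.applications, s.fresh + 1, s.tag + 1 + 1⟩ := by
    rw [hsucc, addCopy]
  rw [hcopy]
  exact ((computes_writeScaled (.inl rfl) (by simp [hx]) (h.var x hxv) h.sourceScale ht hts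
      ht').seqs_cons <|
    (computes_writeScaled (.inr rfl) (by simp [hy]) (h.var y hyv) h.targetScale (by exact ht')
      (by exact htt) (by exact ht'')).seqs_cons <|
    (computes_writeCode (by simp [unaryItems])
      (by simp [unaryItems, Item.eval, code_unaryApp, Memory.building]) hcode).seqs_cons <|
    (computes_writeApply (by decide) (by decide) (by simp [Memory.building, hx])
      (by simp [Memory.building]) ho (h.var x hxv) hv (h.var o hov) h.table).seqs_cons <|
    (computes_writeApply (by decide) (by decide) (by simp [Memory.building])
      (by simp [Memory.building, hy]) ho hv (h.var y hyv) (h.var o hov) h.table).seqs_cons <|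
    (computes_newVar (by exact hv')).seqs_cons <|
    (computes_decay h.ratio (h.weight_mul_ratio hw hw2).2).seqs_cons
      (computes_seqs_nil _)).mono (by
        simp only [unaryItems, List.length_cons, List.length_nil, copyCost]
        omega)

lemma computes_writeCopies (h : G.NumberBounds B tmax vmax wmax) {w : ℝ} {x y o k : ℕ}
    {X Y : List ℝ} (hx : m.sources = (x : ℝ) :: X) (hy : m.targets = (y : ℝ) :: Y)
    (ho : m.falseVar = [(o : ℝ)]) (hhalf : m.half = [1 / 2]) (hxv : x ≤ vmax) (hyv : y ≤ vmax)
    (hov : o ≤ vmax) (htag : 1 ≤ s.tag) (htag2 : s.tag + 2 * k ≤ tmax) (hfresh : s.fresh + k ≤ vmax)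
    (hlo : ∀ i < k, 1 / 2 ≤ w * G.ratio ^ i) (hhi : w * G.ratio ^ k < 1 / 2) (hw : w ≤ wmax) :
    Computes B G.writeCopies (m.building s [w])
      (m.building (G.addCopies o k x y s) [w * G.ratio ^ k]) ((G.copyCost + 1) * k + 1) := by
  induction k generalizing s w with
  | zero =>
    simp only [pow_zero, mul_one] at hhi ⊢
    exact runs_loop_of_not (by simpa [Memory.building, hhalf] using hhi)
  | succ k ih =>
    have hw2 : 1 / 2 ≤ w := by simpa using hlo 0 k.succ_pos
    push_cast at htag2
    have htag3 : s.tag + 2 + 2 * k ≤ tmax := htag2.trans' (le_of_eq (by ring))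
    simp only [pow_succ', ← mul_assoc] at hhi ⊢
    have hcopy := h.computes_writeCopy hx hy ho hxv hyv hov htag (le_self_add.trans htag3)
      (by omega) hw2 hw
    have hcopies := ih (s := G.addCopy o x y s) (w := w * G.ratio) (htag.trans le_self_add) htag3
      (by simp only [addCopy]; omega)
      (fun i hi => by simpa only [pow_succ', ← mul_assoc] using hlo (i + 1) (by omega)) hhi
      ((h.weight_mul_ratio hw2 hw).1.trans hw)
    exact (Runs.loop (by simpa [Memory.building, hhalf] using hw2) hcopy hcopies).mono
      (by ring_nf; omega)

lemma computes_replaceAll (h : G.NumberBounds B tmax vmax wmax) (m : Memory) {z : ℝ} {o k : ℕ}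
    {l : List (ℕ × ℕ)} (ho : m.falseVar = [(o : ℝ)]) (hhalf : m.half = [1 / 2])
    (hflag : m.flag = []) (hspread : m.spread = [z]) (hl : ∀ p ∈ l, p.1 ≤ vmax ∧ p.2 ≤ vmax)
    (hov : o ≤ vmax) (htag : 1 ≤ s.tag) (htag2 : s.tag + 2 * (k * l.length) ≤ tmax)
    (hfresh : s.fresh + k * l.length ≤ vmax) (hz : len (z * z) ≤ B + 1)
    (hlo : ∀ i < k, 1 / 2 ≤ z * z * G.ratio ^ i) (hhi : z * z * G.ratio ^ k < 1 / 2)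
    (hw : z * z ≤ wmax) :
    Computes B G.replaceAll ((m.queue l).building s [])
      ((m.queue []).building (G.addAll o k l s) [])
      (((G.copyCost + 1) * k + 20) * l.length + 6) := by
  refine Iterates.computes (c := ((G.copyCost + 1) * k + 20) * l.length) ?_
  induction l generalizing s with
  | nil => exact .done _ hflag rfl
  | cons p l ih =>
    simp only [List.length_cons, Nat.mul_add, mul_one, Nat.cast_add] at htag2 hfresh
    have htag3 : s.tag + 2 * k + 2 * (k * l.length) ≤ tmax := htag2.trans' (le_of_eq (by ring))
    obtain ⟨hx, hy⟩ := hl p List.mem_cons_self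
    have hsquare : Computes B (.arith .mul Stack.spread Stack.spread Stack.weight)
        ((m.queue (p :: l)).building s [])
        ((m.queue (p :: l)).building s [z * z]) 1 :=
      Prog.Fits.computes (by simpa [Memory.building, Memory.queue, hspread] using hz)
        (by simp [Memory.building, Memory.queue, hspread]) le_rfl
    have hcopies := h.computes_writeCopies (s := s)
      (m := m.queue (p :: l)) rfl rfl ho hhalf hx hy hov htag (le_self_add.trans htag3) (by omega)
      hlo hhi hw
    have hpop : Computes B (seqs [.pop Stack.weight, .pop Stack.sources, .pop Stack.targets])
        ((m.queue (p :: l)).building (G.addCopies o k p.1 p.2 s) [z * z * G.ratio ^ k])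
        ((m.queue l).building (G.addCopies o k p.1 p.2 s) []) 7 :=
      Prog.Fits.computes (by simp) (by simp [Memory.building, Memory.queue, firsts, seconds])
        (by simp)
    have hrest := ih (s := G.addCopies o k p.1 p.2 s)
      (fun q hq => hl q (List.mem_cons_of_mem p hq))
      (by rw [addCopies_tag]; exact htag.trans le_self_add)
      (by rwa [addCopies_tag]) (by rw [addCopies_fresh]; omega)
    refine .step hflag (by simp [Memory.building, Memory.queue, firsts])
      (hsquare.seqs_cons (hcopies.seqs_cons hpop)) hrest ?_
    simp only [List.length_cons]
    ring_nf
    omega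

end NumberBounds

end SupermodularPin

/-! ### The program -/

/-- Move the error tolerance to its stack, and prepare `spread` and `fresh`. -/
def prologue : Prog :=
  seqs [.copy Stack.input Stack.tolerance, .pop Stack.input, .push 1 Stack.spread,
    .push 0 Stack.fresh]

/-- Complete the question by the number of variables and the error tolerance. -/
def finish : Prog :=
  seqs [.push (-1) Stack.query, moveStack Stack.vars Stack.query, .copy Stack.tolerance Stack.query]

/-- Move the first bits of the answer to `bufferB`, as many as there are given variables. -/
def readBits : Prog :=
  untilEmpty Stack.givenVars (seqs [.copy Stack.bufferA Stack.bufferB, .pop Stack.bufferA,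
    .pop Stack.givenVars])

/-- Output the first bits of the answer. -/
def epilogue : Prog := seqs [readBits, moveStack Stack.bufferB Stack.output]

lemma firstBits_succ (n : ℕ) (y : List Bool) :
    firstBits (n + 1) y = y.headD false :: firstBits n y.tail := by
  cases y <;> simp [firstBits, List.ofFn_succ]

section

variable {B n : ℕ} {y : List Bool} {b : List ℝ}

lemma headD_bits (y : List Bool) : (bits y).headD 0 = if y.headD false then 1 else 0 := by
  cases y <;> simp [bits]

lemma len_le_of_mem_bits : ∀ r ∈ bits y, len r ≤ B + 1 := by
  simp only [bits, List.mem_map, forall_exists_index, and_imp]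
  rintro _ b - rfl
  cases b <;> simp

lemma computes_prologue {ε : ℝ} (hε : len ε ≤ B + 1) (I : List ℝ) :
    Computes B prologue { Memory.empty with input := ε :: I }
      { Memory.empty with input := I, tolerance := [ε], spread := [1], fresh := [0] } 9 :=
  Prog.Fits.computes (by simp [prologue, hε]) (by simp [prologue, Memory.empty])
    (by simp [prologue])

lemma computes_finish (m : Memory) (hm : m.flag = []) {ε : ℝ} (hε : len ε ≤ B + 1) :
    Computes B finish { m with vars := List.replicate n 1, tolerance := [ε] }
      { m with
        vars := []
        tolerance := [ε]
        query := ε :: (List.replicate n 1 ++ -1 :: m.query) } (7 * n + 12) := by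
  have hsep : Computes B (.push (-1) Stack.query)
      { m with vars := List.replicate n 1, tolerance := [ε] }
      { m with vars := List.replicate n 1, tolerance := [ε], query := -1 :: m.query } 1 :=
    Prog.Fits.computes (by simp) (by simp) le_rfl
  have hvars := computes_moveStack (B := B) (i := Stack.vars) (j := Stack.query) (by decide)
    (by decide) (by decide) (s := { m with tolerance := [ε] : Memory }.store) hm
    (fun a b => { m with vars := a, tolerance := [ε], query := b }) (fun _ _ => by simp)
    (l := List.replicate n 1) (by simp) (-1 :: m.query)
  rw [List.reverse_replicate, List.length_replicate] at hvars
  have hcopy : Computes B (.copy Stack.tolerance Stack.query)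
      { m with
        vars := []
        tolerance := [ε]
        query := List.replicate n 1 ++ -1 :: m.query }
      { m with
        vars := []
        tolerance := [ε]
        query := ε :: (List.replicate n 1 ++ -1 :: m.query) } 1 :=
    Prog.Fits.computes (by simpa using hε) (by simp) le_rfl
  exact (hsep.seqs_cons (hvars.seqs_cons (hcopy.seqs_cons (computes_seqs_nil _)))).mono (by omega)

lemma computes_readBits (m : Memory) (hm : m.flag = []) :
    Computes B readBits
      { m with givenVars := List.replicate n 1, bufferA := bits y, bufferB := b }
      { m with
        givenVars := []
        bufferA := bits (y.drop n)
        bufferB := (bits (firstBits n y)).reverse ++ b } (9 * n + 6) := by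
  refine Iterates.computes ?_
  induction n generalizing y b with
  | zero => exact .done _ hm rfl
  | succ n ih =>
    have hhead := headD_bits y
    have hlen : len ((bits y).headD 0) ≤ B + 1 := by
      rw [hhead]
      split_ifs <;> simp
    have hbit : Computes B (seqs [.copy Stack.bufferA Stack.bufferB, .pop Stack.bufferA,
          .pop Stack.givenVars])
        { m with givenVars := List.replicate (n + 1) 1, bufferA := bits y, bufferB := b }
        { m with
          givenVars := List.replicate n 1
          bufferA := bits y.tail
          bufferB := (if y.headD false then 1 else 0) :: b } 7 := by
      refine Prog.Fits.computes (by simpa using hlen) ?_ (by simp)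
      rw [← hhead]
      simp [List.replicate_succ, bits, List.map_tail]
    have hrest := ih (y := y.tail) (b := (if y.headD false then 1 else 0) :: b)
    rw [List.drop_tail] at hrest
    refine .step hm (by simp [List.replicate_succ]) hbit ?_ (c := 7) (d := 9 * n) (by omega)
    simpa [firstBits_succ, bits] using hrest

lemma computes_epilogue (m : Memory) (hm : m.flag = []) :
    Computes B epilogue
      { m with givenVars := List.replicate n 1, bufferA := bits y, bufferB := [], output := [] }
      { m with
        givenVars := []
        bufferA := bits (y.drop n)
        bufferB := []
        output := bits (firstBits n y) } (16 * n + 15) := by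
  have hread := computes_readBits (B := B) (n := n) (y := y) (b := []) { m with output := [] } hm
  have hmove := computes_moveStack (B := B) (i := Stack.bufferB) (j := Stack.output) (by decide)
    (by decide) (by decide)
    (s := { m with givenVars := [], bufferA := bits (y.drop n) : Memory }.store) hm
    (fun a b => { m with
      givenVars := []
      bufferA := bits (y.drop n)
      bufferB := a
      output := b }) (fun _ _ => by simp)
    (l := (bits (firstBits n y)).reverse) (by simpa using len_le_of_mem_bits) []
  have hlength : (bits (firstBits n y)).reverse.length = n := by simp [bits, firstBits]
  rw [List.append_nil] at hread
  rw [List.reverse_reverse, List.append_nil, hlength] at hmove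
  exact (hread.seqs_cons (hmove.seqs_cons (computes_seqs_nil _))).mono (by omega)

end

namespace SupermodularPin

variable (G : SupermodularPin)

/-- Prepare the constants, and write `G.initial`. -/
def setup : Prog :=
  seqs [.push (1 / 2) Stack.half, .copy Stack.fresh Stack.falseVar, .push G.base Stack.scratch,
    .arith .add Stack.spread Stack.scratch Stack.tag, .pop Stack.scratch,
    writeItems (unaryItems (.top Stack.fresh) (.const 1) (.const 0)), newVar]

/-- Write the question to the oracle. -/
def question : Prog :=
  seqs [prologue, readUnary, .pop Stack.input, parse, G.setup, G.replaceAll, finish]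

/-- The reduction. -/
def program : Prog := .seq G.question (.seq (.query Stack.query Stack.bufferA) epilogue)

variable {G} {B n k : ℕ} {tmax : ℝ≥0} {vmax : ℕ} {wmax : ℝ} {L : List Application}

lemma NumberBounds.computes_setup (h : G.NumberBounds B tmax vmax wmax) (m : Memory)
    (htag : totalSpread L + G.base ≤ tmax) (hn : n + 1 ≤ vmax) :
    Computes B G.setup
      { m with
        query := (others L).flatMap Application.code
        spread := [(totalSpread L : ℝ)]
        fresh := [(n : ℝ)]
        vars := List.replicate n 1
        tag := []
        weight := []
        falseVar := []
        half := [] }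
      ({ m with
        spread := [(totalSpread L : ℝ)]
        falseVar := [(n : ℝ)]
        half := [1 / 2] }.building (G.initial n L) []) 41 := by
  have htag' := (h.tag _ ((one_le_totalSpread L).trans le_self_add) htag).1
  have hn' := h.var _ hn
  have hhalf := h.half
  push_cast at htag' hn'
  simp only [one_div] at hhalf
  exact Prog.Fits.computes
    (by simp [setup, newVar, writeItems, unaryItems, Item.write, htag', h.var n (by omega), h.base,
      hhalf, hn'])
    (by simp [setup, newVar, writeItems, unaryItems, Item.write, Memory.building, initial,
      code_unaryApp, List.replicate_succ])
    (by simp [setup, newVar, writeItems, unaryItems, Item.write])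

end SupermodularPin

namespace SupermodularPin

variable (G : SupermodularPin)

lemma addAll_fresh (o k : ℕ) (l : List (ℕ × ℕ)) (s : PartialInstance) :
    (G.addAll o k l s).fresh = s.fresh + k * l.length := by
  induction l generalizing s with
  | nil => rfl
  | cons p l ih =>
    refine (ih _).trans ?_
    rw [addCopies_fresh, List.length_cons]
    ring

/-- The contents of the stacks when the question about the instance with `n` variables and
constraints `L` is complete, where each implication is replaced by `k` copies. -/
def asked (n k : ℕ) (L : List Application) (ε : ℝ) : Memory :=
  { Memory.empty with
    query := ε :: (List.replicate (G.result n k L).fresh 1 ++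
      -1 :: (G.result n k L).applications.flatMap Application.code)
    tolerance := [ε]
    spread := [(totalSpread L : ℝ)]
    tag := [((G.result n k L).tag : ℝ)]
    fresh := [((G.result n k L).fresh : ℝ)]
    givenVars := List.replicate n 1
    falseVar := [(n : ℝ)]
    half := [1 / 2] }

/-- A bound for the cost of `question`, for `n` variables, `k` copies of each of `p` implications,
and an input of length `l`. -/
def questionCost (n k p l : ℕ) : ℕ :=
  16 * n + 62 * l + ((G.copyCost + 1) * k + 20) * p + 7 * (n + 1 + k * p) + 100

variable {G} {B n k : ℕ} {tmax : ℝ≥0} {vmax : ℕ} {wmax ε : ℝ} {L : List Application}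

lemma NumberBounds.computes_reading (h : G.NumberBounds B tmax vmax wmax) (hε : len ε ≤ B + 1)
    (hn : n ≤ vmax) (hL : ∀ c ∈ L, ∀ j, c.scope j < n) (hspread : (totalSpread L : ℝ) ≤ 2 ^ B)
    {l : List Prog} {m : Memory} {d : ℕ}
    (hl : Computes B (seqs l)
      { Memory.empty with
        query := (others L).flatMap Application.code
        tolerance := [ε]
        spread := [(totalSpread L : ℝ)]
        fresh := [(n : ℝ)]
        vars := List.replicate n 1
        givenVars := List.replicate n 1
        sources := firsts (impPairs L)
        targets := seconds (impPairs L) } m d) :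
    Computes B (seqs (prologue :: readUnary :: .pop Stack.input :: parse :: l))
      { Memory.empty with
        input := ε :: (List.replicate n 1 ++ -1 :: L.flatMap Application.code) }
      m (16 * n + 62 * (L.flatMap Application.code).length + d + 21) := by
  have hunary := computes_readUnary (B := B) (I := L.flatMap Application.code) (v := 0) (n := n)
    (V := []) (W := []) { Memory.empty with tolerance := [ε], spread := [1] }
    (fun u hu => h.var u (by omega))
  simp only [Nat.zero_add, List.append_nil, Nat.cast_zero] at hunary
  have hpop : Computes B (.pop Stack.input)
      { Memory.empty with
        input := -1 :: L.flatMap Application.code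
        tolerance := [ε]
        spread := [1]
        fresh := [(n : ℝ)]
        vars := List.replicate n 1
        givenVars := List.replicate n 1 }
      { Memory.empty with
        input := L.flatMap Application.code
        tolerance := [ε]
        spread := [1]
        fresh := [(n : ℝ)]
        vars := List.replicate n 1
        givenVars := List.replicate n 1 } 1 :=
    Prog.Fits.computes trivial (by simp) le_rfl
  have hparse := computes_parse (B := B) (z := 1) (L := L)
    { Memory.empty with
      tolerance := [ε]
      fresh := [(n : ℝ)]
      vars := List.replicate n 1
      givenVars := List.replicate n 1 } rfl le_rfl (by rwa [one_mul])
    (fun c hc j => h.var _ (by have := hL c hc j; omega))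
  simp only [one_mul, Memory.parsed, Memory.empty, List.append_nil] at hparse
  exact ((computes_prologue hε _).seqs_cons (hunary.seqs_cons (hpop.seqs_cons
    (hparse.seqs_cons hl)))).mono (by omega)

lemma NumberBounds.computes_question (h : G.NumberBounds B tmax vmax wmax) (hε : len ε ≤ B + 1)
    (hL : ∀ c ∈ L, ∀ j, c.scope j < n) (hspread : (totalSpread L : ℝ) ≤ 2 ^ B)
    (htag : totalSpread L + G.base + 2 * (k * (impPairs L).length) ≤ tmax)
    (hvar : n + 1 + k * (impPairs L).length ≤ vmax)
    (hlo : ∀ i < k, 1 / 2 ≤ (totalSpread L * totalSpread L * G.ratio ^ i : ℝ))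
    (hhi : (totalSpread L * totalSpread L * G.ratio ^ k : ℝ) < 1 / 2)
    (hw : (totalSpread L * totalSpread L : ℝ) ≤ wmax) :
    Computes B G.question
      { Memory.empty with
        input := ε :: (List.replicate n 1 ++ -1 :: L.flatMap Application.code) }
      (G.asked n k L ε)
      (G.questionCost n k (impPairs L).length (L.flatMap Application.code).length) := by
  have hone : (1 : ℝ) ≤ totalSpread L := by exact_mod_cast one_le_totalSpread L
  have hratio : (G.ratio : ℝ) < 1 := by exact_mod_cast G.ratio_lt_one
  have hpairs := impPairs_lt hL
  have hsetup := h.computes_setup (n := n) (L := L)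
    { Memory.empty with
      tolerance := [ε]
      givenVars := List.replicate n 1
      sources := firsts (impPairs L)
      targets := seconds (impPairs L) } (le_self_add.trans htag) (by omega)
  have hreplace := h.computes_replaceAll (s := G.initial n L) (k := k) (o := n) (l := impPairs L)
    { Memory.empty with
      tolerance := [ε]
      spread := [(totalSpread L : ℝ)]
      givenVars := List.replicate n 1
      falseVar := [(n : ℝ)]
      half := [1 / 2] } rfl rfl rfl rfl
    (fun p hp => by have := hpairs p hp; omega) (by omega)
    ((one_le_totalSpread L).trans le_self_add) (by exact_mod_cast htag) hvar
    (h.weight _ (by nlinarith) hw) hlo hhi hw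
  have hfinish := computes_finish (n := (G.result n k L).fresh)
    ({ Memory.empty with
      spread := [(totalSpread L : ℝ)]
      givenVars := List.replicate n 1
      falseVar := [(n : ℝ)]
      half := [1 / 2] }.building (G.result n k L) []) rfl hε
  refine (h.computes_reading hε (by omega) hL hspread (hsetup.seqs_cons (hreplace.seqs_cons
    (hfinish.seqs_cons (computes_seqs_nil _))))).mono ?_
  simp only [result, addAll_fresh, initial, questionCost]
  omega

end SupermodularPin

/-! ### Programs that ask one question -/

section

variable {B c d i a : ℕ} {P Q : Prog} {s s' : Store} {final : List Bool → Store}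

lemma DetPath.run_query (M : Oracle) {n t : ℕ} {b : Config} {k : List Prog}
    (h : DetPath n b ⟨.query i a :: k, s, t⟩) (u : ℕ) :
    run M b (n + (1 + u)) = (M (s i).tail (s.top i)).bind fun y =>
      run M ⟨k, Function.update (Function.update s i []) a (bits y), t + 1⟩ u := by
  rw [h.run_add, MaxProd.run_add, run_one]
  exact PMF.bind_map _ _ _

lemma Runs.detPath_query (hP : Runs B P s s' c) :
    ∃ n t, t ≤ c * (B + 1) + 2 ∧
      DetPath n ⟨[.seq P (.seq (.query i a) Q)], s, 0⟩ ⟨[.query i a, Q], s', t⟩ := by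
  obtain ⟨n, t, -, ht, hpath⟩ := hP [.seq (.query i a) Q] 1
  exact ⟨n + 1 + 1, t + 1, by omega, .head ⟨fun _ => rfl, by simp⟩
    (hpath.trans (.head ⟨fun _ => rfl, by simp⟩ (.refl _)))⟩

lemma Runs.store_eq_of_query (hP : Runs B P s s' c)
    (hQ : ∀ y, Runs B Q (Function.update (Function.update s' i []) a (bits y)) (final y) d)
    (M : Oracle) {t : ℕ} {b : Config}
    (hb : b ∈ (run M ⟨[.seq P (.seq (.query i a) Q)], s, 0⟩ t).support) {j x : ℕ} {k : List Prog}
    (hk : b.todo = .query j x :: k) : b.store j = s' i := by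
  obtain ⟨n, t₁, -, hpath⟩ := hP.detPath_query (i := i) (a := a) (Q := Q)
  rcases lt_trichotomy t n with hlt | rfl | hgt
  · exact absurd hk (hpath.ne_query_of_lt M t hlt b hb j x k)
  · have hrun := hpath.run_add M 0
    rw [Nat.add_zero] at hrun
    simp only [hrun, run, PMF.support_pure, Set.mem_singleton_iff] at hb
    subst hb
    simp only [List.cons.injEq, Prog.query.injEq] at hk
    rw [← hk.1.1]
  · obtain ⟨u, rfl⟩ := Nat.exists_eq_add_of_lt hgt
    rw [Nat.add_assoc, Nat.add_comm u, hpath.run_query, PMF.mem_support_bind_iff] at hb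
    obtain ⟨y, -, hb⟩ := hb
    obtain ⟨n', t', -, -, hpath'⟩ := hQ y [] (t₁ + 1)
    by_cases hu : u < n'
    · exact absurd hk (hpath'.ne_query_of_lt M u hu b hb j x k)
    · obtain ⟨v, rfl⟩ := Nat.exists_eq_add_of_le (not_lt.1 hu)
      rw [hpath'.run_add, run_of_todo_eq_nil M rfl, PMF.support_pure,
        Set.mem_singleton_iff] at hb
      subst hb
      simp at hk

lemma Runs.run_query_eq_map (hP : Runs B P s s' c)
    (hQ : ∀ y, Runs B Q (Function.update (Function.update s' i []) a (bits y)) (final y) d)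
    (M : Oracle) :
    ∃ (t : ℕ) (clock : List Bool → ℕ), (∀ y, clock y ≤ (c + d) * (B + 1) + 3) ∧
      run M ⟨[.seq P (.seq (.query i a) Q)], s, 0⟩ t =
        (M (s' i).tail (s'.top i)).map fun y => ⟨[], final y, clock y⟩ := by
  obtain ⟨n, t, ht, hpath⟩ := hP.detPath_query (i := i) (a := a) (Q := Q)
  choose n' clock hn' hclock hpath' using fun y => hQ y [] (t + 1)
  refine ⟨n + (1 + d * (B + 1)), clock, fun y => ?_, ?_⟩
  · have := hclock y
    rw [Nat.add_mul]
    omega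
  · rw [hpath.run_query, PMF.map]
    congr 1
    funext y
    obtain ⟨v, hv⟩ := Nat.exists_eq_add_of_le (hn' y)
    rw [hv, (hpath' y).run_add, run_of_todo_eq_nil M rfl]
    rfl

end

lemma start_eq (P : Prog) (ε : ℝ) (w : List ℝ) :
    start P ε w = ⟨[P], { Memory.empty with input := ε :: w : Memory }.store, 0⟩ := by
  rw [start, ← Memory.store_empty, (Memory.update_store _ _).1]

/-! ### Bounds for the running time -/

lemma pow_sum_len (l : List ℝ) : (l.map fun r => (4 : ℝ) ^ len r).prod = 4 ^ (l.map len).sum := by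
  induction l with
  | nil => simp
  | cons r l ih => simp [pow_add, ih]

lemma Constraint.spread_le (f : Constraint) : (f.spread : ℝ) ≤ 4 ^ (f.table.map len).sum := by
  rw [f.coe_spread, ← pow_sum_len]
  exact List.prod_map_le_prod_map₀ _ _
    (fun r hr => zero_le_one.trans (one_le_growth (nonneg_of_mem_table hr)))
    fun r hr => growth_le (nonneg_of_mem_table hr)

lemma totalSpread_le (L : List Application) :
    (totalSpread L : ℝ) ≤ 4 ^ ((L.flatMap Application.code).map len).sum := by
  induction L with
  | nil => simp [totalSpread]
  | cons c L ih =>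
    have htable : (c.con.table.map len).sum ≤ (c.code.map len).sum := by
      simp only [Application.code, List.map_append, List.sum_append, List.map_cons, List.sum_cons]
      omega
    rw [totalSpread_cons, NNReal.coe_mul, List.flatMap_cons, List.map_append, List.sum_append,
      pow_add]
    gcongr
    exact c.con.spread_le.trans (pow_le_pow_right₀ (by norm_num) htable)

lemma length_le_sum_len (l : List ℝ) : l.length ≤ (l.map len).sum := by
  rw [← List.length_map len]
  refine List.length_le_sum_of_one_le _ fun n hn => ?_
  obtain ⟨r, -, rfl⟩ := List.mem_map.1 hn
  exact one_le_len r

lemma length_le_length_flatMap_code (L : List Application) :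
    L.length ≤ (L.flatMap Application.code).length := by
  induction L with
  | nil => simp
  | cons c L ih =>
    have := c.length_code
    simp only [List.flatMap_cons, List.length_append, List.length_cons]
    omega

lemma CSPInst.sum_len_code {F : Set Constraint} (x : CSPInst F) : (x.code.map len).sum =
    x.n + 1 + ((x.applications.flatMap Application.code).map len).sum := by
  rw [x.code_eq]
  simp only [List.map_append, List.map_replicate, len_one, List.sum_append, List.sum_replicate,
    smul_eq_mul, mul_one, List.map_cons, len_neg_one, List.sum_cons]
  omega

lemma len_natCast_le (v : ℕ) : len (v : ℝ) ≤ v + 1 := by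
  rcases Nat.eq_zero_or_pos v with rfl | hv
  · simp
  · exact len_le_of_one_le (by exact_mod_cast hv) (by exact_mod_cast v.lt_two_pow_self.le)

lemma len_le_of_lt_one {ε : ℝ} (h0 : 0 < ε) (h1 : ε < 1) : (len ε : ℝ) ≤ 1 / ε + 2 := by
  have hinv : 1 / ε ≤ (2 : ℝ) ^ ⌈1 / ε⌉₊ :=
    (Nat.le_ceil _).trans (by exact_mod_cast Nat.lt_two_pow_self.le)
  rw [div_le_iff₀' h0] at hinv
  have hlen : (len ε : ℝ) ≤ ⌈1 / ε⌉₊ + 1 := by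
    exact_mod_cast len_le_of_bounds h0 hinv (h1.le.trans (one_le_pow₀ one_le_two))
  linarith [Nat.ceil_lt_add_one (show 0 ≤ 1 / ε by positivity)]

lemma two_le_mul_two_pow_len {r : ℝ} (h : 0 < r) : 2 ≤ r * 2 ^ len r := by
  have hinv := two_mul_le_two_pow_len (inv_pos.2 h)
  rw [len_inv] at hinv
  calc (2 : ℝ) = r * (2 * r⁻¹) := by field_simp
    _ ≤ r * 2 ^ len r := by gcongr

lemma len_mul_le {N : ℕ} {t r : ℝ} (h1 : 1 ≤ t) (h2 : t ≤ 2 ^ N) (hr : 0 < r) :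
    len (t * r) ≤ N + len r + 1 := by
  have hlower := two_le_mul_two_pow_len hr
  have hupper := two_mul_le_two_pow_len hr
  have hN : (1 : ℝ) ≤ 2 ^ N := one_le_pow₀ one_le_two
  refine len_le_of_bounds (by positivity) ?_ ?_ <;> rw [pow_add]
  · calc (1 : ℝ) ≤ t * (2 ^ N * (r * 2 ^ len r)) :=
          one_le_mul_of_one_le_of_one_le h1 (one_le_mul_of_one_le_of_one_le hN (by linarith))
      _ = t * r * (2 ^ N * 2 ^ len r) := by ring
  · exact mul_le_mul h2 (by linarith) hr.le (by positivity)

lemma two_pow_add_two_pow_add_two_pow_le (a b c : ℕ) :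
    (2 : ℝ) ^ a + 2 ^ b + 2 ^ c ≤ 2 ^ (a + b + c + 2) := by
  have hle {i : ℕ} (hi : i ≤ a + b + c) : (2 : ℝ) ^ i ≤ 2 ^ (a + b + c) :=
    pow_le_pow_right₀ one_le_two hi
  rw [pow_add 2 (a + b + c)]
  have hpos : (0 : ℝ) < 2 ^ (a + b + c) := by positivity
  linarith [hle (i := a) (by omega), hle (i := b) (by omega), hle (i := c) (by omega)]

namespace SupermodularPin

variable (G : SupermodularPin)

/-- The total length of the constants of the program. -/
def constLen : ℕ :=
  (G.con.table.map len).sum + len (G.sourceScale : ℝ) + len (G.targetScale : ℝ) +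
    len (G.sourceScale * G.targetScale : ℝ) + len (G.ratio : ℝ) + len (G.base : ℝ)

lemma tag_le_two_pow {S q : ℕ} {z : ℝ} (hz : z ≤ 4 ^ S) :
    z + G.base + 2 * q ≤ 2 ^ (2 * S + len (G.base : ℝ) + 2 * q + 2) := by
  have hbase := two_mul_le_two_pow_len (show (0 : ℝ) < G.base from G.base_pos)
  have hq : (2 * q : ℝ) ≤ 2 ^ (2 * q) := by exact_mod_cast (2 * q).lt_two_pow_self.le
  have hz' : z ≤ 2 ^ (2 * S) := by
    rw [pow_mul]
    norm_num [hz]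
  linarith [two_pow_add_two_pow_add_two_pow_le (2 * S) (len (G.base : ℝ)) (2 * q),
    G.base.coe_nonneg]

lemma len_weight_le {S : ℕ} {w z : ℝ} (hz0 : 0 ≤ z) (hz : z ≤ 4 ^ S) (hlo : G.ratio / 2 ≤ w)
    (hhi : w ≤ z * z) : len w ≤ 4 * S + len (G.ratio : ℝ) + 1 := by
  have hratio : (0 : ℝ) < G.ratio := G.ratio_pos
  have hlower := two_le_mul_two_pow_len hratio
  have hone : (1 : ℝ) ≤ 2 ^ len (G.ratio : ℝ) := one_le_pow₀ one_le_two
  have hS : (1 : ℝ) ≤ 2 ^ (4 * S) := one_le_pow₀ one_le_two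
  have hsquare : z * z ≤ 2 ^ (4 * S) := by
    calc z * z ≤ 4 ^ S * 4 ^ S := mul_le_mul hz hz hz0 (by positivity)
      _ = 2 ^ (4 * S) := by rw [← mul_pow, pow_mul]; norm_num
  refine len_le_of_bounds (by linarith) ?_ ?_ <;> rw [pow_add]
  · have hw : 1 ≤ w * 2 ^ len (G.ratio : ℝ) := by nlinarith
    calc (1 : ℝ) ≤ 2 ^ (4 * S) * (w * 2 ^ len (G.ratio : ℝ)) :=
          one_le_mul_of_one_le_of_one_le hS hw
      _ = w * (2 ^ (4 * S) * 2 ^ len (G.ratio : ℝ)) := by ring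
  · exact (hhi.trans hsquare).trans (le_mul_of_one_le_right (by positivity) hone)

lemma numberBounds {B S n q : ℕ} {z : ℝ≥0} (hz : (z : ℝ) ≤ 4 ^ S) (hn : n ≤ S)
    (hB : 5 * S + 3 * q + G.constLen + 10 ≤ B) :
    G.NumberBounds B (z + G.base + 2 * q) (n + 1 + q) (z * z) := by
  simp only [constLen] at hB
  refine ⟨?_, fun r hr => ?_, by omega, by omega, by omega, by omega, by omega, fun t h1 h2 => ?_,
    fun v hv => (len_natCast_le v).trans (by omega),
    fun w hlo hhi => (G.len_weight_le z.coe_nonneg hz hlo hhi).trans (by omega)⟩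
  · exact (len_le_of_bounds (N := 1) (by norm_num) (by norm_num) (by norm_num)).trans (by omega)
  · have := List.single_le_sum (by simp) _ (List.mem_map_of_mem (f := len) hr)
    omega
  · have h1' : (1 : ℝ) ≤ t := by exact_mod_cast h1
    have h2' := le_trans (by exact_mod_cast h2) (G.tag_le_two_pow (q := q) hz)
    exact ⟨(len_le_of_one_le h1' h2').trans (by omega),
      (len_mul_le h1' h2' (by exact_mod_cast G.sourceScale_pos)).trans (by omega),
      (len_mul_le h1' h2' (by exact_mod_cast G.targetScale_pos)).trans (by omega)⟩

lemma exists_copies {D S : ℕ} (hD : (G.ratio : ℝ) ^ D ≤ 1 / 2) {z : ℝ} (h0 : 0 ≤ z)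
    (hz : z ≤ 4 ^ S) :
    ∃ k ≤ D * (4 * S + 2), (∀ i < k, 1 / 2 ≤ z * z * G.ratio ^ i) ∧
      z * z * G.ratio ^ k < 1 / 2 := by
  have hex : z * z * G.ratio ^ (D * (4 * S + 2)) < 1 / 2 := by
    calc z * z * G.ratio ^ (D * (4 * S + 2))
        = z * z * ((G.ratio : ℝ) ^ D) ^ (4 * S + 2) := by rw [pow_mul]
      _ ≤ 4 ^ S * 4 ^ S * (1 / 2 : ℝ) ^ (4 * S + 2) := by gcongr
      _ = 1 / 4 := by
        rw [pow_add, pow_mul, ← mul_assoc, ← mul_pow, ← mul_pow]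
        norm_num
      _ < 1 / 2 := by norm_num
  classical
  have hex' : ∃ k : ℕ, z * z * (G.ratio : ℝ) ^ k < 1 / 2 := ⟨_, hex⟩
  exact ⟨Nat.find hex', Nat.find_min' hex' hex, fun i hi => not_lt.1 (Nat.find_min hex' hi),
    Nat.find_spec hex'⟩

end SupermodularPin

namespace SupermodularPin

variable (G : SupermodularPin) {D s : ℕ} {ε : ℝ}

/-- A bound for the number of links in the question about an instance of size `s`, where `D` is
such that `G.ratio ^ D ≤ 1 / 2`. -/
def linkBound (D s : ℕ) : ℕ := D * (4 * s + 2) * s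

/-- A bound for the length of every number that the program writes. -/
def lengthBound (D s : ℕ) (ε : ℝ) : ℕ :=
  len ε + 5 * s + 3 * linkBound D s + G.constLen + 10

/-- A bound for the cost of the program. -/
def costBound (D s : ℕ) : ℕ := 122 + 121 * s + (G.copyCost + 8) * linkBound D s

/-- The coefficient of the polynomial that bounds the running time. -/
def timeCoeff (D : ℕ) : ℕ :=
  (243 + 6 * D * (G.copyCost + 8)) * (18 * D + G.constLen + 20) + 3

/-- The polynomial that bounds the running time in terms of the size and `1 / ε`. -/
def timePoly (D : ℕ) : MvPolynomial (Fin 2) ℝ :=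
  MvPolynomial.C (G.timeCoeff D : ℝ) * (MvPolynomial.X 0 + MvPolynomial.X 1 + 1) ^ 4

lemma eval_timePoly (a b : ℝ) :
    MvPolynomial.eval ![a, b] (G.timePoly D) = G.timeCoeff D * (a + b + 1) ^ 4 := by
  simp [timePoly]

lemma linkBound_le {u : ℝ} (hs : (s : ℝ) ≤ u) (hu : 1 ≤ u) :
    (linkBound D s : ℝ) ≤ 6 * D * u ^ 2 := by
  rw [linkBound]
  push_cast
  calc (D * (4 * s + 2) * s : ℝ) ≤ D * (4 * u + 2 * u) * u := by gcongr; linarith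
    _ = 6 * D * u ^ 2 := by ring

lemma clock_le_eval_timePoly (h0 : 0 < ε) (h1 : ε < 1) :
    ((G.costBound D s * (G.lengthBound D s ε + 1) + 3 : ℕ) : ℝ) ≤
      MvPolynomial.eval ![(s : ℝ), 1 / ε] (G.timePoly D) := by
  rw [eval_timePoly]
  have hε : 0 < 1 / ε := by positivity
  have hlen := len_le_of_lt_one h0 h1
  set u : ℝ := s + 1 / ε + 1 with hu
  have hsu : (s : ℝ) ≤ u := by linarith [hu]
  have hu1 : 1 ≤ u := by linarith [hu]
  have hu2 : u ≤ u ^ 2 := le_self_pow₀ hu1 two_ne_zero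
  have hlinks := linkBound_le (D := D) hsu hu1
  have hlength : (G.lengthBound D s ε + 1 : ℝ) ≤ (18 * D + G.constLen + 20) * u ^ 2 := by
    have hconst : (G.constLen : ℝ) ≤ G.constLen * u ^ 2 :=
      le_mul_of_one_le_right (Nat.cast_nonneg _) (hu1.trans hu2)
    rw [lengthBound]
    push_cast
    linarith
  have hcost : (G.costBound D s : ℝ) ≤ (243 + 6 * D * (G.copyCost + 8)) * u ^ 2 := by
    have := mul_le_mul_of_nonneg_left hlinks (show (0 : ℝ) ≤ G.copyCost + 8 by positivity)
    rw [costBound]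
    push_cast
    linarith
  have hmul := mul_le_mul hcost hlength (by positivity) (by positivity)
  have hu4 : 1 ≤ u ^ 4 := one_le_pow₀ hu1
  rw [timeCoeff]
  push_cast
  linarith

lemma inv_le_eval_timePoly (h0 : 0 < ε) :
    1 / ε ≤ MvPolynomial.eval ![(s : ℝ), 1 / ε] (G.timePoly D) := by
  rw [eval_timePoly]
  have hε : 0 < 1 / ε := by positivity
  have hcoeff : (1 : ℝ) ≤ G.timeCoeff D := by
    exact_mod_cast Nat.le_add_left_of_le (show 1 ≤ 3 by norm_num)
  calc 1 / ε ≤ s + 1 / ε + 1 := by linarith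
    _ ≤ (s + 1 / ε + 1) ^ 4 := le_self_pow₀ (by linarith) (by norm_num)
    _ ≤ G.timeCoeff D * (s + 1 / ε + 1) ^ 4 := le_mul_of_one_le_left (by positivity) hcoeff

lemma questionCost_le {n k p l : ℕ} (hn : n ≤ s) (hl : l ≤ s) (hp : p ≤ s)
    (hkp : k * p ≤ linkBound D s) : G.questionCost n k p l + (16 * n + 15) ≤ G.costBound D s := by
  have hcopies := Nat.mul_le_mul_left (G.copyCost + 8) hkp
  have hsplit : ((G.copyCost + 1) * k + 20) * p + 7 * (n + 1 + k * p) =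
      (G.copyCost + 8) * (k * p) + 20 * p + 7 * n + 7 := by ring
  rw [questionCost, costBound]
  omega

lemma exists_computes_question {F : Set Constraint} (x : CSPInst F)
    (hD : (G.ratio : ℝ) ^ D ≤ 1 / 2) (hs : s = (x.code.map len).sum) (ε : ℝ) :
    ∃ k c, G.ratio ^ k * (totalSpread x.applications * totalSpread x.applications) < 1 / 2 ∧
      c + (16 * x.n + 15) ≤ G.costBound D s ∧
      Computes (G.lengthBound D s ε) G.question { Memory.empty with input := ε :: x.code }
        (G.asked x.n k x.applications ε) c := by
  have hsize := hs.trans x.sum_len_code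
  have hn : x.n ≤ s := by omega
  have hl : (x.applications.flatMap Application.code).length ≤ s :=
    (length_le_sum_len _).trans (by omega)
  have hp : (impPairs x.applications).length ≤ s :=
    ((length_impPairs_le _).trans (length_le_length_flatMap_code _)).trans hl
  have hspread : (totalSpread x.applications : ℝ) ≤ 4 ^ s :=
    (totalSpread_le _).trans (pow_le_pow_right₀ (by norm_num) (by omega))
  obtain ⟨k, hk, hlo, hhi⟩ := G.exists_copies hD (NNReal.coe_nonneg _) hspread
  have hkp : k * (impPairs x.applications).length ≤ linkBound D s := Nat.mul_le_mul hk hp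
  have hB : 2 * s ≤ G.lengthBound D s ε := by rw [lengthBound]; omega
  have hspread2 : (totalSpread x.applications : ℝ) ≤ 2 ^ G.lengthBound D s ε := by
    refine hspread.trans ?_
    rw [show (4 : ℝ) = 2 ^ 2 by norm_num, ← pow_mul]
    exact pow_le_pow_right₀ one_le_two hB
  have hbounds := G.numberBounds (B := G.lengthBound D s ε) hspread hn
    (q := k * (impPairs x.applications).length) (by rw [lengthBound]; omega)
  rw [x.code_eq]
  refine ⟨k, _, ?_, G.questionCost_le hn hl hp hkp, hbounds.computes_question
    (by rw [lengthBound]; omega) x.scope_lt_of_mem_applications hspread2 (by push_cast; rfl) le_rfl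
    hlo hhi le_rfl⟩
  rw [mul_comm]
  exact_mod_cast hhi

end SupermodularPin

lemma SupermodularPin.computes_epilogue_asked (G : SupermodularPin) (B n k : ℕ)
    (L : List Application) (ε : ℝ) (y : List Bool) :
    Runs B epilogue
      (Function.update (Function.update (G.asked n k L ε).store Stack.query []) Stack.bufferA
        (bits y))
      { G.asked n k L ε with
        query := []
        givenVars := []
        bufferA := bits (y.drop n)
        bufferB := []
        output := bits (firstBits n y) : Memory }.store (16 * n + 15) := by
  have hepilogue := computes_epilogue (B := B) (n := n) (y := y)
    { G.asked n k L ε with query := [] } rfl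
  simp only [Memory.update_store]
  exact hepilogue

lemma two_rpow_lt_two {ε : ℝ} (h : ε < 1) : (2 : ℝ) ^ ε < 2 :=
  (Real.rpow_lt_rpow_of_exponent_lt one_lt_two h).trans_eq (Real.rpow_one 2)

theorem SupermodularPin.aptReduces (G : SupermodularPin) {A S : Set Constraint} (hG : G.con ∈ S)
    (hU : Unary ⊆ S) (hA : ∀ c ∈ A, c ≠ Implies → c ∈ S) :
    APTReduces (maxProdCSP A) (maxProdCSP S) := by
  obtain ⟨D, hD⟩ := exists_pow_lt_of_lt_one (one_half_pos (α := ℝ))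
    (show (G.ratio : ℝ) < 1 by exact_mod_cast G.ratio_lt_one)
  refine ⟨G.program, G.timePoly D, fun M hM (x : CSPInst A) ε h0 h1 => ?_⟩
  obtain ⟨k, c, hk, hcost, hquestion⟩ := G.exists_computes_question x hD.le rfl ε
  have hvalid := G.result_applications_valid x (m := k) hG hU hA
  set w : CSPInst S := PartialInstance.toInst _ hvalid with hw
  have hasked : (G.asked x.n k x.applications ε).query = ε :: w.code := by
    rw [hw, PartialInstance.code_toInst]
    rfl
  have hepilogue := G.computes_epilogue_asked (G.lengthBound D (x.code.map len).sum ε) x.n k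
    x.applications ε
  obtain ⟨t, clock, hclock, hrun⟩ := hquestion.run_query_eq_map hepilogue M
  have hanswer : (M ((G.asked x.n k x.applications ε).store Stack.query).tail
      ((G.asked x.n k x.applications ε).store.top Stack.query)) = M w.code ε :=
    congrArg (fun q : List ℝ => M q.tail (q.headD 0)) hasked
  rw [hanswer] at hrun
  rw [start_eq, SupermodularPin.program, show (maxProdCSP A).code x = x.code from rfl]
  refine ⟨fun t b hb i a todo htodo => ⟨w, ε, ?_, h0, h1, G.inv_le_eval_timePoly h0⟩, t, ?_, ?_⟩
  · exact (hquestion.store_eq_of_query hepilogue M hb htodo).trans hasked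
  · intro b hb
    rw [hrun, PMF.support_map] at hb
    obtain ⟨y, -, rfl⟩ := hb
    refine ⟨rfl, le_trans ?_ (G.clock_le_eval_timePoly h0 h1)⟩
    exact_mod_cast (hclock y).trans (Nat.add_le_add_right (Nat.mul_le_mul_right _ hcost) 3)
  · rw [hrun, PMF.toOuterMeasure_map_apply]
    refine (hM w ε h0 h1).trans (MeasureTheory.measure_mono fun y hy => ?_)
    exact ⟨firstBits x.n y, rfl, G.isApprox_firstBits x hvalid hk (K := ⟨2 ^ ε, by positivity⟩)
      (Real.one_le_rpow one_le_two h0.le) (two_rpow_lt_two h1) hy⟩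

end MaxProd

end

theorem mainTheorem6 (F : Set MaxProd.Constraint) (f : MaxProd.Constraint)
    (hIM : f ∈ MaxProd.IMopt) (hdeg : ¬ MaxProd.Degenerate f)
    (himp : ¬ MaxProd.HasImpSupport f) :
    MaxProd.APTReduces (MaxProd.maxProdCSPStar ({MaxProd.Implies} ∪ F))
      (MaxProd.maxProdCSPStar ({f} ∪ F)) := by
  have hpos := MaxProd.val_ne_zero_of_mem_IMopt hIM himp
  obtain ⟨i, j, hij, hlt⟩ := MaxProd.exists_strictlyLogSupermodular_pin hIM hdeg hpos
  refine MaxProd.SupermodularPin.aptReduces ⟨f, i, j, hij, hpos, hlt⟩ (Or.inl (Or.inl rfl))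
    Set.subset_union_right ?_
  rintro c ((hc | hc) | hc) hne
  · exact absurd hc hne
  · exact Or.inl (Or.inr hc)
  · exact Or.inr hc
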